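/- Let $K$ be a non-Archimedean local field with residue field of cardinality $q$, normalized absolute value $|\cdot|$, ring of integers $O$, and Haar measure $dx$ with $\int_O dx=1$. On $K^n$ put $\|x\|=\max_j|x_j|$ and use the product measure $d^nx$; $L_p$ means $L_p(K^n)$ and $*$ is convolution over $K^n$. Fix an additive character $\chi$ of $K$ of rank zero (trivial on $O$, and $\chi(x_0)\neq1$ for some $|x_0|=q$), and define on $K^n$ the Fourier transform $\widetilde f(\xi)=\int\chi(x\cdot\xi)f(x)\,d^nx$ with inverse $g\mapsto\int\chi(-x\cdot\xi)g(\xi)\,d^n\xi$, and similarly on $K$. Let $\Phi(K^n)$ be the space of locally constant compactly supported $\varphi:K^n\to\mathbb C$ with $\int\varphi\,d^nx=0$. For $\alpha>0$ let $D^{\alpha}$ and $D^{\alpha,n}$ be the pseudo-differential operators on $\Phi(K)$ and $\Phi(K^n)$ with symbols $|\xi|^\alpha$ and $\|\xi\|^\alpha$. Consider the equation $$D_t^\alpha F-D_x^{\alpha,n}F=0,\qquad t\in K,\ x\in K^n, \tag{W}$$ for functions $F:K\times K^n\to\mathbb C$ such that $F(\cdot,x)\in\Phi(K)$ depends only on $|t|$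 for each $x$, and $F(t,\cdot)\in\Phi(K^n)$ for each $t$. Put $$A(x)=\frac{1-q^{-n+1}}{1-q^{-1}}\|x\|^{-1},\qquad B_t(x)=|t|^{-n}\,\widetilde b(t^{-1}x)\ (t\ne0),\qquad \widetilde b(\zeta)=\begin{cases}\frac{q-q^n}{q-1},&\|\zeta\|\le q^{-1},\\ \frac{q}{q-1},&\|\zeta\|=1,\\ 0,&\|\zeta\|>1.\end{cases}$$ **(1)** Let $n\ge2$. For every $\alpha>0$ and $\varphi\in\Phi(K^n)$ the modified Cauchy problem consisting of (W) and $(D_t^{n-1}F)(0,x)=\varphi(x)$ has exactly one solution $F_2$ in this class, and $$F_2(t,\cdot)=A*B_t*\varphi\quad(t\neq0),\qquad F_2(0,\cdot)=A*\varphi ,$$ the convolutions being absolutely convergent, with $A*B_t*\varphi=A*(B_t*\varphi)$. There is a constant $C$, independent of $\alpha,\varphi,\varkappa,t$, such that $\|F_2(t,\cdot)\|_{L_\varkappa}\le C\|A*\varphi\|_{L_\varkappa}$ for all $\alpha>0$, $\varphi\in\Phi(K^n)$, $1<\varkappa<\infty$ and $t\in K$. For every $1<\varkappa<\frac n{n-1}$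 there is a constant $C'$, independent of $\alpha,\varphi,t$, such that for all $\alpha>0$, $\varphi\in\Phi(K^n)$ and $t\in K$ $$\|F_2(t,\cdot)\|_{L_\lambda}\le C'\|\varphi\|_{L_\varkappa},\qquad \lambda=\frac{n\varkappa}{n-\varkappa(n-1)} .$$ **(2)** Let $n\ge1$. For every $\alpha>0$ and $\varphi\in\Phi(K^n)$ the Cauchy problem consisting of (W) and $F(0,x)=\varphi(x)$ has exactly one solution $F_1$ in this class, and $F_1(t,\cdot)=B_t*\varphi$ for $t\ne0$ (absolutely convergent). There is a constant $C$, independent of $\alpha,\varphi,\varkappa,t$, such that $\|F_1(t,\cdot)\|_{L_\varkappa}\le C\|\varphi\|_{L_\varkappa}$ for all $\alpha>0$, $\varphi\in\Phi(K^n)$, $1<\varkappa<\infty$ and $t\in K$. -/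

import Mathlib

open MeasureTheory
open scoped NNReal ENNReal

namespace NAWave

noncomputable section

section Field

variable (K : Type*) [NontriviallyNormedField K] [IsUltrametricDist K]

open scoped NormedField Valued in
/-- The cardinality `q` of the residue field `O / P`, where `O` is the closed and `P` the open
unit ball of `K`. -/
def residueCard : ℕ := Nat.card 𝓀[K]

/-- The absolute value of `K` is normalized: a prime element `β` (that is, `P = βO`) has
absolute value `q⁻¹`. -/
def IsNormalizedAbs : Prop :=
  ∃ β : K, {x : K | ‖x‖ < 1} = {x : K | ∃ y : K, ‖y‖ ≤ 1 ∧ x = β * y} ∧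
    ‖β‖ = (residueCard K : ℝ)⁻¹

end Field

variable {K : Type*} [NontriviallyNormedField K]

/-- A rank zero additive character: trivial on `O`, but not on all elements of absolute
value `q`. (Triviality on the open subgroup `O` already makes it continuous.) -/
structure IsRankZero [IsUltrametricDist K] (χ : AddChar K Circle) : Prop where
  trivial_on_integers : ∀ x : K, ‖x‖ ≤ 1 → χ x = 1
  nontrivial_on_sphere : ∃ x : K, ‖x‖ = residueCard K ∧ χ x ≠ 1

section Measure

variable (K) [LocallyCompactSpace K] [MeasurableSpace K] [BorelSpace K]

/-- The closed unit ball `O` as a compact set with non-empty interior. -/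
def unitBall : TopologicalSpace.PositiveCompacts K where
  carrier := Metric.closedBall 0 1
  isCompact' :=
    haveI : ProperSpace K := ProperSpace.of_locallyCompactSpace K
    isCompact_closedBall 0 1
  interior_nonempty' :=
    ⟨0, Metric.ball_subset_interior_closedBall (Metric.mem_ball_self one_pos)⟩

/-- The Haar measure of the additive group of `K` for which `O` has measure `1`. -/
def haar : Measure K := Measure.addHaarMeasure (unitBall K)

/-- The product Haar measure `dⁿx` on `Kⁿ`. The norm on `Fin n → K` is `max |x_j|`. -/
def haarPi (n : ℕ) : Measure (Fin n → K) := Measure.pi fun _ => haar K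

end Measure

variable [LocallyCompactSpace K] [MeasurableSpace K] [BorelSpace K]

/-! Test functions. -/

/-- The Lizorkin space `Φ(K)`: locally constant functions with compact support and
integral zero. -/
structure IsLizorkinLine (f : K → ℂ) : Prop where
  isLocallyConstant : IsLocallyConstant f
  hasCompactSupport : HasCompactSupport f
  integral_eq_zero : ∫ x, f x ∂(haar K) = 0

/-- The Lizorkin space `Φ(Kⁿ)`: locally constant functions with compact support and
integral zero. -/
structure IsLizorkin {n : ℕ} (f : (Fin n → K) → ℂ) : Prop where
  isLocallyConstant : IsLocallyConstant f
  hasCompactSupport : HasCompactSupport f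
  integral_eq_zero : ∫ x, f x ∂(haarPi K n) = 0

/-! The Fourier transform and the pseudo-differential operators. -/

/-- The Fourier transform on `K`. -/
def fourierLine (χ : AddChar K Circle) (f : K → ℂ) (ξ : K) : ℂ :=
  ∫ x, (χ (x * ξ) : ℂ) * f x ∂(haar K)

/-- The inverse Fourier transform on `K`. -/
def fourierLineInv (χ : AddChar K Circle) (g : K → ℂ) (x : K) : ℂ :=
  ∫ ξ, (χ (-(x * ξ)) : ℂ) * g ξ ∂(haar K)

/-- The fractional differentiation operator `D^α` on functions of one variable, with symbol
`|ξ|^α`. -/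
def fracDerivLine (χ : AddChar K Circle) (α : ℝ) (f : K → ℂ) : K → ℂ :=
  fourierLineInv χ fun ξ => ((‖ξ‖ ^ α : ℝ) : ℂ) * fourierLine χ f ξ

/-- The Fourier transform on `Kⁿ`. -/
def fourier {n : ℕ} (χ : AddChar K Circle) (f : (Fin n → K) → ℂ) (ξ : Fin n → K) : ℂ :=
  ∫ x, (χ (∑ j, x j * ξ j) : ℂ) * f x ∂(haarPi K n)

/-- The inverse Fourier transform on `Kⁿ`. -/
def fourierInv {n : ℕ} (χ : AddChar K Circle) (g : (Fin n → K) → ℂ) (x : Fin n → K) : ℂ :=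
  ∫ ξ, (χ (-∑ j, x j * ξ j) : ℂ) * g ξ ∂(haarPi K n)

/-- The operator `D^{α,n}` on functions of `n` variables, with symbol `‖ξ‖^α`. -/
def fracDeriv {n : ℕ} (χ : AddChar K Circle) (α : ℝ) (f : (Fin n → K) → ℂ) :
    (Fin n → K) → ℂ :=
  fourierInv χ fun ξ => ((‖ξ‖ ^ α : ℝ) : ℂ) * fourier χ f ξ

/-! The Cauchy problems. -/

/-- `F(t, x)` is a solution of the wave equation `D_t^α F - D_x^{α,n} F = 0` which, for each `x`,
belongs to `Φ(K)` and is radial in `t` and, for each `t`, belongs to `Φ(Kⁿ)` in `x`. -/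
structure IsWaveSolution {n : ℕ} (χ : AddChar K Circle) (α : ℝ)
    (F : K → (Fin n → K) → ℂ) : Prop where
  lizorkin_time : ∀ x, IsLizorkinLine fun t => F t x
  radial_time : ∀ x t t', ‖t‖ = ‖t'‖ → F t x = F t' x
  lizorkin_space : ∀ t, IsLizorkin (F t)
  equation : ∀ t x, fracDerivLine χ α (fun s => F s x) t - fracDeriv χ α (F t) x = 0

/-- The Cauchy problem: the wave equation with `F(0, x) = φ(x)`. -/
structure IsCauchySolution {n : ℕ} (χ : AddChar K Circle) (α : ℝ) (φ : (Fin n → K) → ℂ)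
    (F : K → (Fin n → K) → ℂ) : Prop extends IsWaveSolution χ α F where
  initial : ∀ x, F 0 x = φ x

/-- The modified Cauchy problem: the wave equation with `(D_t^{n-1} F)(0, x) = φ(x)`. It is used
for `n ≥ 2` only. -/
structure IsModifiedCauchySolution {n : ℕ} (χ : AddChar K Circle) (α : ℝ)
    (φ : (Fin n → K) → ℂ) (F : K → (Fin n → K) → ℂ) : Prop extends IsWaveSolution χ α F where
  initial : ∀ x, fracDerivLine χ ((n : ℝ) - 1) (fun s => F s x) 0 = φ x

/-! The kernels and the convolution. -/

/-- The kernel `A(x) = (1 - q^{-n+1}) / (1 - q^{-1}) · ‖x‖⁻¹`. -/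
def kernelA [IsUltrametricDist K] {n : ℕ} (x : Fin n → K) : ℂ :=
  (((1 - (residueCard K : ℝ) ^ (-(n : ℤ) + 1)) / (1 - (residueCard K : ℝ)⁻¹) * ‖x‖⁻¹ : ℝ) : ℂ)

/-- The function `b̃`. -/
def bTilde [IsUltrametricDist K] {n : ℕ} (ζ : Fin n → K) : ℂ :=
  if ‖ζ‖ ≤ (residueCard K : ℝ)⁻¹ then
    ((residueCard K : ℂ) - (residueCard K : ℂ) ^ n) / ((residueCard K : ℂ) - 1)
  else if ‖ζ‖ = 1 then (residueCard K : ℂ) / ((residueCard K : ℂ) - 1)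
  else 0

/-- The kernel `B_t(x) = |t|^{-n} b̃(t⁻¹ x)`, for `t ≠ 0`. -/
def kernelB [IsUltrametricDist K] {n : ℕ} (t : K) (x : Fin n → K) : ℂ :=
  ((‖t‖ ^ n)⁻¹ : ℝ) * bTilde (t⁻¹ • x)

/-- Convolution on `Kⁿ`: `(f * g)(x) = ∫ f(y) g(x - y) dⁿy`. -/
def conv {n : ℕ} (f g : (Fin n → K) → ℂ) : (Fin n → K) → ℂ :=
  convolution f g (ContinuousLinearMap.mul ℂ ℂ) (haarPi K n)

/-- The integral defining `(f * g)(x)` converges absolutely for every `x`. -/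
def ConvExists {n : ℕ} (f g : (Fin n → K) → ℂ) : Prop :=
  ConvolutionExists f g (ContinuousLinearMap.mul ℂ ℂ) (haarPi K n)

/-- The norm of `L_p(Kⁿ)` for a real exponent `p`. -/
def normL {n : ℕ} (p : ℝ) (f : (Fin n → K) → ℂ) : ℝ≥0∞ :=
  eLpNorm f (ENNReal.ofReal p) (haarPi K n)

end

end NAWave

open NAWave

/-!
For `m : ℤ` let `P_m f` be the average of `f` over balls of radius `q ^ (-m)`. On locally constant
compactly supported functions with integral zero, `E_j = P_j - P_{j-1}` is the projection onto the
frequencies `‖ξ‖ = q ^ j`, only finitely many `E_j f` are nonzero, and the operator with symbol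
`‖ξ‖ ^ α` is `f ↦ ∑ j, q ^ (j α) • E_j f`. In one variable the radial functions at frequency `q ^ j`
form a line, spanned by a profile `w_j` with `w_j(0) = 1`. The wave equation compares time
frequencies with space frequencies, which the injective symbol `q ^ (j α)` separates; its
solutions are exactly `F(t) = ∑ j, w_j(t) • E_j F(0)`. For uniqueness this needs `E_j F(·, x)(0)`
to equal `E_j F(0)(x)`. The difference of the sums of these over `j ≤ l` is in `l` a martingale over
shrinking balls, and it vanishes for large `l`, though not uniformly in `x`: by compactness of balls
such a martingale is zero.

Convolution with `B_t` is the multiplier `w_j(t)`, because `b̃` is a combination of the indicators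
of two balls; convolution with `A` is the multiplier `q ^ (-j (n - 1))`, that is, the Riesz
potential of order `n - 1`, because `‖x‖⁻¹` is a superposition of indicators of balls. Hence
convolution with `B_t` is a combination of two averages with coefficients independent of `t`, and
Jensen's inequality bounds it on every `L_p`. The bound from `L_κ` to `L_λ` is Hedberg's
inequality together with Doob's maximal inequality: averages over increasing balls are
conditional expectations.
-/

namespace NAWave

/-! ### Locally constant functions and averages over balls -/

section LocallyConstant

variable {E X Y Z W W' W'' : Type*}

/-- `f` is constant on every closed ball of radius `r`. -/
def IsConstOnBalls [PseudoMetricSpace E] (r : ℝ) (f : E → X) : Prop :=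
  ∀ ⦃x y⦄, dist x y ≤ r → f x = f y

section PseudoMetric

variable [PseudoMetricSpace E] {r s : ℝ} {f : E → X} {g : E → Y}

theorem IsConstOnBalls.mono (hf : IsConstOnBalls s f) (hrs : r ≤ s) : IsConstOnBalls r f :=
  fun _ _ h => hf (h.trans hrs)

theorem IsConstOnBalls.comp₂ (hf : IsConstOnBalls r f) (hg : IsConstOnBalls r g) (u : X → Y → Z) :
    IsConstOnBalls r fun x => u (f x) (g x) :=
  fun _ _ h => congrArg₂ u (hf h) (hg h)

theorem IsConstOnBalls.isLocallyConstant (hf : IsConstOnBalls r f) (hr : 0 < r) :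
    IsLocallyConstant f :=
  (IsLocallyConstant.iff_eventually_eq f).2 fun x =>
    Filter.mem_of_superset (Metric.closedBall_mem_nhds x hr) fun _ hy => hf hy

end PseudoMetric

/-- Test functions: locally constant functions with compact support. -/
structure IsTest [TopologicalSpace E] [Zero W] (f : E → W) : Prop where
  isLocallyConstant : IsLocallyConstant f
  hasCompactSupport : HasCompactSupport f

namespace IsTest

section Topological

variable [TopologicalSpace E] {f : E → W}

theorem continuous [Zero W] [TopologicalSpace W] (hf : IsTest f) : Continuous f :=
  hf.isLocallyConstant.continuous

theorem comp [Zero W] [Zero W'] (hf : IsTest f) {u : W → W'} (hu : u 0 = 0) :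
    IsTest fun x => u (f x) :=
  ⟨hf.isLocallyConstant.comp u, hf.hasCompactSupport.comp_left hu⟩

theorem comp₂ [Zero W] [Zero W'] [Zero W''] {g : E → W'} (hf : IsTest f) (hg : IsTest g)
    {u : W → W' → W''} (hu : u 0 0 = 0) : IsTest fun x => u (f x) (g x) :=
  ⟨hf.isLocallyConstant.comp₂ hg.isLocallyConstant u,
    hf.hasCompactSupport.comp₂_left hg.hasCompactSupport hu⟩

theorem sum [AddCommMonoid W] {ι : Type*} (s : Finset ι) {f : ι → E → W}
    (hf : ∀ i ∈ s, IsTest (f i)) : IsTest fun x => ∑ i ∈ s, f i x := by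
  induction s using Finset.cons_induction with
  | empty => exact ⟨IsLocallyConstant.const 0, HasCompactSupport.zero⟩
  | cons i s hi ih =>
    simp only [Finset.sum_cons]
    exact (hf i (Finset.mem_cons_self i s)).comp₂
      (ih fun j hj => hf j (Finset.mem_cons_of_mem hj)) (zero_add 0)

theorem integrable [NormedAddCommGroup W] [MeasurableSpace E] [OpensMeasurableSpace E]
    {μ : Measure E} [IsFiniteMeasureOnCompacts μ] (hf : IsTest f) : Integrable f μ :=
  hf.continuous.integrable_of_hasCompactSupport hf.hasCompactSupport

end Topological

theorem exists_isConstOnBalls [PseudoMetricSpace E] [Zero W] {f : E → W} (hf : IsTest f) :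
    ∃ r > 0, IsConstOnBalls r f := by
  -- For the discrete uniformity on `W`, uniform continuity means constancy on small balls.
  let _ : UniformSpace W := ⊥
  have huc : UniformContinuous f :=
    hf.hasCompactSupport.uniformContinuous_of_continuous hf.continuous
  obtain ⟨r, hr, h⟩ := Metric.mem_uniformity_dist.1
    (huc (show {p : W × W | p.1 = p.2} ∈ uniformity W from Filter.mem_principal_self _))
  exact ⟨r / 2, half_pos hr, fun x y hxy => h (hxy.trans_lt (half_lt_self hr))⟩

theorem exists_norm_le [SeminormedAddCommGroup E] [Zero W] {f : E → W} (hf : IsTest f) :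
    ∃ R, ∀ x, f x ≠ 0 → ‖x‖ ≤ R := by
  obtain ⟨R, hR⟩ := hf.hasCompactSupport.isCompact.isBounded.exists_norm_le
  exact ⟨R, fun x hx => hR x (subset_tsupport f hx)⟩

theorem exists_isConstOnBalls_zpow [SeminormedAddCommGroup E] [Zero W] {f : E → W}
    (hf : IsTest f) {q : ℝ} (hq : 1 < q) :
    ∃ J : ℕ, IsConstOnBalls (q ^ (-(J : ℤ))) f ∧ ∀ x, f x ≠ 0 → ‖x‖ ≤ q ^ (J : ℤ) := by
  obtain ⟨r, hr, hconst⟩ := hf.exists_isConstOnBalls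
  obtain ⟨R, hR⟩ := hf.exists_norm_le
  obtain ⟨J, hJ⟩ := pow_unbounded_of_one_lt (max r⁻¹ R) hq
  refine ⟨J, hconst.mono ?_, fun x hx => (hR x hx).trans ?_⟩
  · rw [zpow_neg, zpow_natCast]
    exact inv_le_of_inv_le₀ hr ((le_max_left _ _).trans hJ.le)
  · rw [zpow_natCast]
    exact (le_max_right _ _).trans hJ.le

end IsTest

theorem IsConstOnBalls.isTest [SeminormedAddCommGroup E] [ProperSpace E] [Zero W] {f : E → W}
    {r R : ℝ} (hf : IsConstOnBalls r f) (hr : 0 < r) (hR : ∀ x, f x ≠ 0 → ‖x‖ ≤ R) : IsTest f :=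
  ⟨hf.isLocallyConstant hr, .of_support_subset_isCompact (isCompact_closedBall 0 R) fun x hx =>
    mem_closedBall_zero_iff.2 (hR x hx)⟩

theorem mem_closedBall_iff_of_dist_le [PseudoMetricSpace E] [IsUltrametricDist E] {x y z : E}
    {r : ℝ} (h : dist y z ≤ r) : y ∈ Metric.closedBall x r ↔ z ∈ Metric.closedBall x r := by
  rw [Metric.mem_closedBall_comm, Metric.mem_closedBall_comm (x := z),
    IsUltrametricDist.closedBall_eq_of_mem (Metric.mem_closedBall.2 h)]

end LocallyConstant

section BallAverage

variable {E W : Type*} [MeasurableSpace E] [NormedAddCommGroup W] [NormedSpace ℝ W]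

/-- The average of `f` over the closed ball of radius `r` around `x`. As a function of `x` it is
the conditional expectation of `f` with respect to the partition into balls of radius `r`. -/
noncomputable def ballAvg [PseudoMetricSpace E] (μ : Measure E) (r : ℝ) (f : E → W) (x : E) : W :=
  ⨍ y in Metric.closedBall x r, f y ∂μ

section Metric

variable [PseudoMetricSpace E] {μ : Measure E} {r s : ℝ} {f g : E → W} {x : E}

theorem isConstOnBalls_ballAvg [IsUltrametricDist E] (μ : Measure E) (r : ℝ) (f : E → W) :
    IsConstOnBalls r (ballAvg μ r f) := fun _ _ h => by
  rw [ballAvg, ballAvg, IsUltrametricDist.closedBall_eq_of_mem (Metric.mem_closedBall.2 h)]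

theorem ballAvg_congr [OpensMeasurableSpace E]
    (h : ∀ y, dist y x ≤ r → f y = g y) : ballAvg μ r f x = ballAvg μ r g x :=
  setAverage_congr_fun Metric.isClosed_closedBall.measurableSet (.of_forall h)

theorem ballAvg_smul {𝕜 : Type*} [NormedDivisionRing 𝕜] [Module 𝕜 W] [NormSMulClass 𝕜 W]
    [SMulCommClass ℝ 𝕜 W] (c : 𝕜) (f : E → W) (x : E) :
    ballAvg μ r (fun y => c • f y) x = c • ballAvg μ r f x :=
  integral_smul c f

theorem IsConstOnBalls.ballAvg_smul [OpensMeasurableSpace E] {h : E → ℝ} (hh : IsConstOnBalls r h)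
    (g : E → W) (x : E) : ballAvg μ r (fun y => h y • g y) x = h x • ballAvg μ r g x := by
  rw [ballAvg_congr (g := fun y => h x • g y) fun y hy => by rw [hh hy], NAWave.ballAvg_smul]

theorem ballAvg_indicator_closedBall [OpensMeasurableSpace E] [IsUltrametricDist E] (hrs : r ≤ s)
    (f : E → W) (x : E) :
    ballAvg μ r ((Metric.closedBall x s).indicator f) =
      (Metric.closedBall x s).indicator (ballAvg μ r f) := by
  ext y
  have hmem (z : E) (hz : dist z y ≤ r) : z ∈ Metric.closedBall x s ↔ y ∈ Metric.closedBall x s :=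
    mem_closedBall_iff_of_dist_le (hz.trans hrs)
  by_cases hy : y ∈ Metric.closedBall x s
  · rw [Set.indicator_of_mem hy]
    exact ballAvg_congr fun z hz => Set.indicator_of_mem ((hmem z hz).2 hy) f
  · rw [Set.indicator_of_notMem hy,
      ballAvg_congr (g := 0) fun z hz => Set.indicator_of_notMem (mt (hmem z hz).1 hy) f]
    exact integral_zero _ _

variable [ProperSpace E]

theorem ballAvg_sub (hf : LocallyIntegrable f μ) (hg : LocallyIntegrable g μ) (x : E) :
    ballAvg μ r (fun y => f y - g y) x = ballAvg μ r f x - ballAvg μ r g x := by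
  have hx : IsCompact (Metric.closedBall x r) := isCompact_closedBall x r
  simp only [ballAvg, setAverage_eq, ← smul_sub]
  rw [integral_sub (hf.integrableOn_isCompact hx) (hg.integrableOn_isCompact hx)]

theorem ballAvg_sum {ι : Type*} (S : Finset ι) {f : ι → E → W}
    (hf : ∀ i ∈ S, LocallyIntegrable (f i) μ) (x : E) :
    ballAvg μ r (fun y => ∑ i ∈ S, f i y) x = ∑ i ∈ S, ballAvg μ r (f i) x := by
  simp only [ballAvg, setAverage_eq, ← Finset.smul_sum]
  rw [integral_finsetSum S fun i hi => (hf i hi).integrableOn_isCompact (isCompact_closedBall x r)]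

variable [IsFiniteMeasureOnCompacts μ] [μ.IsOpenPosMeasure] [CompleteSpace W]

theorem ballAvg_const (hr : 0 < r) (c : W) (x : E) : ballAvg μ r (fun _ => c) x = c :=
  setAverage_const (Metric.measure_closedBall_pos μ x hr).ne' measure_closedBall_lt_top.ne c

theorem IsConstOnBalls.ballAvg_eq [OpensMeasurableSpace E] (hf : IsConstOnBalls r f) (hr : 0 < r) :
    ballAvg μ r f = f := by
  ext x
  rw [ballAvg_congr fun y hy => hf hy, ballAvg_const hr]

end Metric

section Group

variable [NormedAddCommGroup E] [IsUltrametricDist E] {μ : Measure E} {r s : ℝ} {f : E → W} {x : E}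

theorem ballAvg_eq_zero_of_integral_eq_zero [OpensMeasurableSpace E]
    (hf : ∀ y, f y ≠ 0 → ‖y‖ ≤ r) (h0 : ∫ y, f y ∂μ = 0) (x : E) : ballAvg μ r f x = 0 := by
  have hf' (y : E) (hy : y ∉ Metric.closedBall (0 : E) r) : f y = 0 :=
    not_imp_comm.1 (hf y) (mt mem_closedBall_zero_iff.2 hy)
  rcases IsUltrametricDist.closedBall_eq_or_disjoint x 0 r with heq | hdisj
  · rw [ballAvg, heq, setAverage_eq, setIntegral_eq_integral_of_forall_compl_eq_zero hf', h0,
      smul_zero]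
  · rw [ballAvg_congr (g := 0) fun y hy => hf' y (Set.disjoint_left.1 hdisj hy)]
    exact integral_zero _ _

theorem norm_le_of_ballAvg_ne_zero [OpensMeasurableSpace E] (hrs : r ≤ s)
    (hf : ∀ y, f y ≠ 0 → ‖y‖ ≤ s) (hx : ballAvg μ r f x ≠ 0) : ‖x‖ ≤ s := by
  have hind : (Metric.closedBall 0 s).indicator f = f :=
    Set.indicator_eq_self.2 fun y hy => mem_closedBall_zero_iff.2 (hf y hy)
  rw [← hind, ballAvg_indicator_closedBall hrs] at hx
  exact mem_closedBall_zero_iff.1 (Set.mem_of_indicator_ne_zero hx)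

theorem ballAvg_eq_setAverage_add [BorelSpace E] [μ.IsAddHaarMeasure] (f : E → W)
    (x : E) :
    ballAvg μ r f x = ⨍ z in Metric.closedBall 0 r, f (x + z) ∂μ := by
  have hpre : (fun z => x + z) ⁻¹' Metric.closedBall x r = Metric.closedBall 0 r := by
    ext z; simp
  rw [ballAvg, setAverage_eq, setAverage_eq, Measure.addHaar_real_closedBall_center,
    ← (measurePreserving_add_left μ x).setIntegral_preimage_emb
      (MeasurableEquiv.addLeft x).measurableEmbedding f, hpre]

variable [ProperSpace E]

protected theorem IsTest.ballAvg [OpensMeasurableSpace E] (hf : IsTest f) (hr : 0 < r) :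
    IsTest (ballAvg μ r f) := by
  obtain ⟨R, hR⟩ := hf.exists_norm_le
  exact (isConstOnBalls_ballAvg μ r f).isTest hr fun x hx =>
    norm_le_of_ballAvg_ne_zero (le_max_right R r) (fun y hy => (hR y hy).trans (le_max_left R r)) hx

variable [BorelSpace E] [μ.IsAddHaarMeasure]

theorem integral_ballAvg [CompleteSpace W] (hr : 0 < r) (hf : Integrable f μ) :
    ∫ x, ballAvg μ r f x ∂μ = ∫ x, f x ∂μ := by
  set ν := μ.restrict (Metric.closedBall (0 : E) r)
  have : IsFiniteMeasure ν := ⟨by simpa [ν] using measure_closedBall_lt_top⟩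
  have hint : Integrable (fun p : E × E => f (p.1 + p.2)) (μ.prod ν) :=
    (measurePreserving_add_prod μ ν).integrable_comp_of_integrable (hf.comp_fst ν)
  calc ∫ x, ballAvg μ r f x ∂μ
      = ∫ x, (μ.real (Metric.closedBall 0 r))⁻¹ • ∫ z, f (x + z) ∂ν ∂μ := by
        simp only [ballAvg_eq_setAverage_add, setAverage_eq, ν]
    _ = (μ.real (Metric.closedBall 0 r))⁻¹ • ∫ z, ∫ x, f (x + z) ∂μ ∂ν := by
        rw [integral_smul, integral_integral_swap hint]
    _ = ballAvg μ r (fun _ => ∫ x, f x ∂μ) (0 : E) := by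
        simp only [integral_add_right_eq_self, ballAvg, setAverage_eq, ν]
    _ = ∫ x, f x ∂μ := ballAvg_const hr _ _

theorem integral_smul_ballAvg [CompleteSpace W] (hr : 0 < r) {h : E → ℝ}
    (hh : IsConstOnBalls r h) (hint : Integrable (fun x => h x • f x) μ) :
    ∫ x, h x • ballAvg μ r f x ∂μ = ∫ x, h x • f x ∂μ := by
  simp only [← hh.ballAvg_smul, integral_ballAvg hr hint]

theorem ballAvg_ballAvg_of_le [CompleteSpace W] (hr : 0 < r) (hrs : r ≤ s)
    (hf : LocallyIntegrable f μ) : ballAvg μ s (ballAvg μ r f) = ballAvg μ s f := by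
  ext x
  have hmeas : MeasurableSet (Metric.closedBall x s) := Metric.isClosed_closedBall.measurableSet
  rw [ballAvg, ballAvg, setAverage_eq, setAverage_eq, ← integral_indicator hmeas,
    ← integral_indicator hmeas, ← ballAvg_indicator_closedBall hrs, integral_ballAvg hr
      ((integrable_indicator_iff hmeas).2 (hf.integrableOn_isCompact (isCompact_closedBall x s)))]

theorem ballAvg_ballAvg [CompleteSpace W] (hr : 0 < r) (hs : 0 < s) (hf : LocallyIntegrable f μ) :
    ballAvg μ s (ballAvg μ r f) = ballAvg μ (max s r) f := by
  rcases le_total r s with h | h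
  · rw [ballAvg_ballAvg_of_le hr h hf, max_eq_left h]
  · rw [((isConstOnBalls_ballAvg μ r f).mono h).ballAvg_eq hs, max_eq_right h]

end Group

end BallAverage

/-! ### Frequency decomposition -/

section Multipliers

variable {E : Type*} [NormedAddCommGroup E] [MeasurableSpace E]

/-- Test functions with integral zero. This is the space `Φ` for both `K` and `Kⁿ`. -/
structure IsMeanZeroTest (μ : Measure E) (f : E → ℂ) : Prop extends IsTest f where
  integral_eq_zero : ∫ x, f x ∂μ = 0

/-- The part of `f` with frequencies of norm at most `q ^ j`: the average over balls of radius
`q ^ (-j)`. -/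
noncomputable abbrev lowPass (μ : Measure E) (q : ℝ) (j : ℤ) (f : E → ℂ) : E → ℂ :=
  ballAvg μ (q ^ (-j)) f

/-- The part of `f` with frequencies of norm `q ^ j`. -/
noncomputable def bandPass (μ : Measure E) (q : ℝ) (j : ℤ) (f : E → ℂ) (x : E) : ℂ :=
  lowPass μ q j f x - lowPass μ q (j - 1) f x

/-- The operator that multiplies the part of frequency `q ^ j` by `a j`. The sum is finite for
mean zero test functions. -/
noncomputable def multiplier (μ : Measure E) (q : ℝ) (a : ℤ → ℂ) (f : E → ℂ) (x : E) : ℂ :=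
  ∑ᶠ j : ℤ, a j * bandPass μ q j f x

/-- All frequencies of `f` have norms in `(q ^ (-J), q ^ J]`. -/
structure HasBand (μ : Measure E) (q : ℝ) (J : ℕ) (f : E → ℂ) : Prop where
  lowPass_eq_self : ∀ j : ℤ, J ≤ j → lowPass μ q j f = f
  lowPass_eq_zero : ∀ j : ℤ, j ≤ -J → lowPass μ q j f = 0

variable {μ : Measure E} {q : ℝ} {f g : E → ℂ} {J : ℕ}

theorem HasBand.bandPass_eq_zero (hf : HasBand μ q J f) {j : ℤ}
    (hj : j ∉ Finset.Ioc (-(J : ℤ)) J) : bandPass μ q j f = 0 := by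
  ext x
  rw [Finset.mem_Ioc, not_and_or] at hj
  rcases hj with hj | hj
  · simp [bandPass, hf.lowPass_eq_zero j (by omega), hf.lowPass_eq_zero (j - 1) (by omega)]
  · simp [bandPass, hf.lowPass_eq_self j (by omega), hf.lowPass_eq_self (j - 1) (by omega)]

theorem HasBand.multiplier_eq_sum (hf : HasBand μ q J f) (a : ℤ → ℂ) :
    multiplier μ q a f = fun x => ∑ j ∈ Finset.Ioc (-(J : ℤ)) J, a j * bandPass μ q j f x := by
  ext x
  refine finsum_eq_sum_of_support_subset _ fun j hj => ?_
  by_contra hmem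
  exact hj (by simp [hf.bandPass_eq_zero hmem])

theorem sum_Ioc_sub_pred {A : Type*} [AddCommGroup A] (g : ℤ → A) {a b : ℤ} (hab : a ≤ b) :
    ∑ j ∈ Finset.Ioc a b, (g j - g (j - 1)) = g b - g a := by
  induction b, hab using Int.leInduction with
  | base => simp
  | succ b hb ih =>
    have hinsert : Finset.Ioc a (b + 1) = insert (b + 1) (Finset.Ioc a b) := by
      ext x; simp only [Finset.mem_Ioc, Finset.mem_insert]; omega
    rw [hinsert, Finset.sum_insert (by simp), ih, add_sub_cancel_right]
    abel

theorem HasBand.multiplier_one (hf : HasBand μ q J f) : multiplier μ q (fun _ => 1) f = f := by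
  ext x
  simp only [hf.multiplier_eq_sum, one_mul, bandPass]
  rw [sum_Ioc_sub_pred (fun j => lowPass μ q j f x) (by omega), hf.lowPass_eq_self J le_rfl,
    hf.lowPass_eq_zero _ le_rfl, Pi.zero_apply, sub_zero]

theorem bandPass_const_mul (j : ℤ) (c : ℂ) (f : E → ℂ) (x : E) :
    bandPass μ q j (fun y => c * f y) x = c * bandPass μ q j f x := by
  simp only [bandPass, lowPass, ← smul_eq_mul, ballAvg_smul, smul_sub]

section Algebra

namespace IsMeanZeroTest

theorem const_mul (hf : IsMeanZeroTest μ f) (c : ℂ) : IsMeanZeroTest μ fun x => c * f x :=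
  ⟨hf.comp (mul_zero c), by rw [integral_const_mul, hf.integral_eq_zero, mul_zero]⟩

variable [OpensMeasurableSpace E] [IsFiniteMeasureOnCompacts μ]

theorem locallyIntegrable (hf : IsMeanZeroTest μ f) : LocallyIntegrable f μ :=
  hf.integrable.locallyIntegrable

theorem sub (hf : IsMeanZeroTest μ f) (hg : IsMeanZeroTest μ g) :
    IsMeanZeroTest μ fun x => f x - g x :=
  ⟨hf.comp₂ hg.toIsTest (sub_zero 0), by
    rw [integral_sub hf.integrable hg.integrable, hf.integral_eq_zero, hg.integral_eq_zero,
      sub_zero]⟩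

theorem sum_mul {ι : Type*} (S : Finset ι) (c : ι → ℂ) {f : ι → E → ℂ}
    (hf : ∀ i ∈ S, IsMeanZeroTest μ (f i)) : IsMeanZeroTest μ fun x => ∑ i ∈ S, c i * f i x :=
  ⟨.sum S fun i hi => ((hf i hi).const_mul (c i)).toIsTest, by
    rw [integral_finsetSum S fun i hi => ((hf i hi).const_mul (c i)).integrable]
    exact Finset.sum_eq_zero fun i hi => ((hf i hi).const_mul (c i)).integral_eq_zero⟩

end IsMeanZeroTest

end Algebra

section Proper

variable [ProperSpace E]

theorem bandPass_sub (hf : LocallyIntegrable f μ) (hg : LocallyIntegrable g μ) (j : ℤ) (x : E) :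
    bandPass μ q j (fun y => f y - g y) x = bandPass μ q j f x - bandPass μ q j g x := by
  simp only [bandPass, lowPass, ballAvg_sub hf hg]
  ring

theorem bandPass_sum_mul {ι : Type*} (S : Finset ι) (c : ι → ℂ) {f : ι → E → ℂ}
    (hf : ∀ i ∈ S, LocallyIntegrable (f i) μ) (j : ℤ) (x : E) :
    bandPass μ q j (fun y => ∑ i ∈ S, c i * f i y) x = ∑ i ∈ S, c i * bandPass μ q j (f i) x := by
  have hcf (i : ι) (hi : i ∈ S) : LocallyIntegrable (fun y => c i * f i y) μ :=
    (hf i hi).smul (c i)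
  rw [bandPass, lowPass, lowPass, ballAvg_sum S hcf, ballAvg_sum S hcf, ← Finset.sum_sub_distrib]
  exact Finset.sum_congr rfl fun i _ => bandPass_const_mul j (c i) (f i) x

end Proper

section Ultrametric

variable [IsUltrametricDist E]

theorem isConstOnBalls_bandPass (hq : 1 < q) (μ : Measure E) (j : ℤ) (f : E → ℂ) :
    IsConstOnBalls (q ^ (-j)) (bandPass μ q j f) :=
  (isConstOnBalls_ballAvg μ _ f).comp₂ ((isConstOnBalls_ballAvg μ (q ^ (-(j - 1))) f).mono
    (zpow_le_zpow_right₀ hq.le (by omega))) (· - ·)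

end Ultrametric

section Haar

variable [IsUltrametricDist E] [ProperSpace E] [BorelSpace E]

theorem IsMeanZeroTest.hasBand [μ.IsOpenPosMeasure] [IsFiniteMeasureOnCompacts μ] (hq : 1 < q)
    (hf : IsMeanZeroTest μ f) (hconst : IsConstOnBalls (q ^ (-(J : ℤ))) f)
    (hsupp : ∀ x, f x ≠ 0 → ‖x‖ ≤ q ^ (J : ℤ)) : HasBand μ q J f where
  lowPass_eq_self j hj := (hconst.mono (zpow_le_zpow_right₀ hq.le (by omega))).ballAvg_eq
    (zpow_pos (zero_lt_one.trans hq) _)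
  lowPass_eq_zero j hj := funext <| ballAvg_eq_zero_of_integral_eq_zero
    (fun x hx => (hsupp x hx).trans (zpow_le_zpow_right₀ hq.le (by omega))) hf.integral_eq_zero

theorem IsMeanZeroTest.exists_hasBand [μ.IsOpenPosMeasure] [IsFiniteMeasureOnCompacts μ]
    (hq : 1 < q) (hf : IsMeanZeroTest μ f) : ∃ J : ℕ, HasBand μ q J f :=
  let ⟨J, hconst, hsupp⟩ := hf.exists_isConstOnBalls_zpow hq
  ⟨J, hf.hasBand hq hconst hsupp⟩

variable [μ.IsAddHaarMeasure]

theorem lowPass_lowPass (hq : 1 < q) (hf : LocallyIntegrable f μ) (i j : ℤ) :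
    lowPass μ q i (lowPass μ q j f) = lowPass μ q (min i j) f := by
  have hq0 : 0 < q := zero_lt_one.trans hq
  rw [lowPass, lowPass, lowPass, ballAvg_ballAvg (zpow_pos hq0 _) (zpow_pos hq0 _) hf,
    ← (zpow_right_strictMono₀ hq).monotone.map_max, max_neg_neg]

theorem locallyIntegrable_lowPass (hq : 1 < q) (j : ℤ) (f : E → ℂ) :
    LocallyIntegrable (lowPass μ q j f) μ :=
  ((isConstOnBalls_ballAvg μ _ f).isLocallyConstant
    (zpow_pos (zero_lt_one.trans hq) _)).continuous.locallyIntegrable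

theorem lowPass_bandPass (hq : 1 < q) (hf : LocallyIntegrable f μ) (i j : ℤ) :
    lowPass μ q i (bandPass μ q j f) = if j ≤ i then bandPass μ q j f else 0 := by
  have hmin : lowPass μ q i (bandPass μ q j f) =
      fun x => lowPass μ q (min i j) f x - lowPass μ q (min i (j - 1)) f x := by
    ext x
    rw [← lowPass_lowPass hq hf, ← lowPass_lowPass hq hf]
    exact ballAvg_sub (locallyIntegrable_lowPass hq j f) (locallyIntegrable_lowPass hq (j - 1) f) x
  rw [hmin]
  split_ifs with h
  · rw [min_eq_right h, min_eq_right (by omega)]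
    rfl
  · rw [min_eq_left (by omega), min_eq_left (by omega)]
    exact funext fun x => sub_self _

theorem bandPass_lowPass (hq : 1 < q) (hf : LocallyIntegrable f μ) (i j : ℤ) :
    bandPass μ q i (lowPass μ q j f) = if i ≤ j then bandPass μ q i f else 0 := by
  ext x
  rw [bandPass, lowPass_lowPass hq hf, lowPass_lowPass hq hf]
  split_ifs with h
  · rw [min_eq_left h, min_eq_left (by omega), bandPass]
  · rw [min_eq_right (by omega), min_eq_right (by omega), sub_self, Pi.zero_apply]

theorem bandPass_bandPass (hq : 1 < q) (hf : LocallyIntegrable f μ) (i j : ℤ) :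
    bandPass μ q i (bandPass μ q j f) = if i = j then bandPass μ q j f else 0 := by
  ext x
  rw [bandPass, lowPass_bandPass hq hf, lowPass_bandPass hq hf]
  split_ifs <;> first | omega | simp

namespace IsMeanZeroTest

protected theorem lowPass (hq : 1 < q) (hf : IsMeanZeroTest μ f) (j : ℤ) :
    IsMeanZeroTest μ (lowPass μ q j f) :=
  have hr : 0 < q ^ (-j) := zpow_pos (zero_lt_one.trans hq) _
  ⟨hf.ballAvg hr, (integral_ballAvg hr hf.integrable).trans hf.integral_eq_zero⟩

protected theorem bandPass (hq : 1 < q) (hf : IsMeanZeroTest μ f) (j : ℤ) :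
    IsMeanZeroTest μ (bandPass μ q j f) :=
  (hf.lowPass hq j).sub (hf.lowPass hq (j - 1))

protected theorem multiplier (hq : 1 < q) (hf : IsMeanZeroTest μ f) (a : ℤ → ℂ) :
    IsMeanZeroTest μ (multiplier μ q a f) := by
  obtain ⟨J, hJ⟩ := hf.exists_hasBand hq
  rw [hJ.multiplier_eq_sum a]
  exact sum_mul _ a fun j _ => hf.bandPass hq j

theorem multiplier_one (hq : 1 < q) (hf : IsMeanZeroTest μ f) :
    multiplier μ q (fun _ => 1) f = f :=
  let ⟨_, hJ⟩ := hf.exists_hasBand hq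
  hJ.multiplier_one

theorem ext_bandPass (hq : 1 < q) (hf : IsMeanZeroTest μ f) (hg : IsMeanZeroTest μ g)
    (h : ∀ j, bandPass μ q j f = bandPass μ q j g) : f = g := by
  rw [← hf.multiplier_one hq, ← hg.multiplier_one hq]
  ext x
  simp only [multiplier, h]

theorem bandPass_multiplier (hq : 1 < q) (hf : IsMeanZeroTest μ f) (a : ℤ → ℂ) (i : ℤ) (x : E) :
    bandPass μ q i (multiplier μ q a f) x = a i * bandPass μ q i f x := by
  obtain ⟨J, hJ⟩ := hf.exists_hasBand hq
  rw [hJ.multiplier_eq_sum a,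
    bandPass_sum_mul _ a fun j _ => (hf.bandPass hq j).locallyIntegrable]
  simp only [bandPass_bandPass hq hf.locallyIntegrable, ite_apply, Pi.zero_apply, mul_ite,
    mul_zero, Finset.sum_ite_eq]
  split_ifs with hi
  · rfl
  · rw [hJ.bandPass_eq_zero hi, Pi.zero_apply, mul_zero]

theorem eq_multiplier (hq : 1 < q) (hf : IsMeanZeroTest μ f) (hg : IsMeanZeroTest μ g) {a : ℤ → ℂ}
    (h : ∀ j x, bandPass μ q j g x = a j * bandPass μ q j f x) : g = multiplier μ q a f :=
  hg.ext_bandPass hq (hf.multiplier hq a) fun j => funext fun x => by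
    rw [h, hf.bandPass_multiplier hq]

theorem multiplier_multiplier (hq : 1 < q) (hf : IsMeanZeroTest μ f) (a b : ℤ → ℂ) :
    multiplier μ q a (multiplier μ q b f) = multiplier μ q (fun j => a j * b j) f := by
  ext x
  simp only [multiplier, hf.bandPass_multiplier hq, mul_assoc]

theorem lowPass_eq_multiplier (hq : 1 < q) (hf : IsMeanZeroTest μ f) (m : ℤ) :
    lowPass μ q m f = multiplier μ q (fun j => if j ≤ m then 1 else 0) f :=
  hf.eq_multiplier hq (hf.lowPass hq m) fun j x => by
    rw [bandPass_lowPass hq hf.locallyIntegrable]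
    split_ifs <;> simp

theorem multiplier_sum_mul (hq : 1 < q) {ι : Type*} (S : Finset ι) (c : ι → ℂ) {f : ι → E → ℂ}
    (hf : ∀ i ∈ S, IsMeanZeroTest μ (f i)) (a : ℤ → ℂ) :
    multiplier μ q a (fun y => ∑ i ∈ S, c i * f i y) =
      fun x => ∑ i ∈ S, c i * multiplier μ q a (f i) x :=
  Eq.symm <| (sum_mul S c hf).eq_multiplier hq
    (sum_mul S c fun i hi => (hf i hi).multiplier hq a) fun j x => by
    rw [bandPass_sum_mul S c fun i hi => (hf i hi).locallyIntegrable,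
      bandPass_sum_mul S c fun i hi => ((hf i hi).multiplier hq a).locallyIntegrable,
      Finset.mul_sum]
    refine Finset.sum_congr rfl fun i hi => ?_
    rw [(hf i hi).bandPass_multiplier hq, mul_left_comm]

end IsMeanZeroTest

end Haar

end Multipliers

/-! ### Fourier multipliers -/

/-- The Haar measure `μ` and the norm of `E` are those of an `n`-dimensional space over a
non-Archimedean local field with residue field of cardinality `q`: nonzero norms are powers of `q`
and the ball of radius `q ^ m` has volume `q ^ (m * n)`. -/
structure IsNormalizedHaar {E : Type*} [NormedAddCommGroup E] [MeasurableSpace E] (μ : Measure E)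
    (q : ℝ) (n : ℕ) : Prop where
  one_lt : 1 < q
  norm_eq_zpow : ∀ x : E, x ≠ 0 → ∃ m : ℤ, ‖x‖ = q ^ m
  measureReal_closedBall : ∀ m : ℤ, μ.real (Metric.closedBall 0 (q ^ m)) = (q ^ m) ^ n

/-- A bicharacter of `E` with values in the circle, for which the ball of radius `q ^ (-m)` is the
annihilator of the ball of radius `q ^ m`. For `Kⁿ` it is `χ (x · y)`. -/
structure IsSelfDualPairing {E : Type*} [NormedAddCommGroup E] (q : ℝ) (e : E → E → Circle) :
    Prop where
  symm : ∀ x y, e x y = e y x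
  map_add_right : ∀ x y z, e x (y + z) = e x y * e x z
  eq_one : ∀ x y, ‖x‖ * ‖y‖ ≤ 1 → e x y = 1
  exists_ne_one : ∀ x (m : ℤ), 1 < ‖x‖ * q ^ m → ∃ y, ‖y‖ ≤ q ^ m ∧ e x y ≠ 1

theorem eq_zero_of_eq_mul {z : Circle} {I : ℂ} (hz : z ≠ 1) (h : I = z * I) : I = 0 :=
  (mul_left_eq_self₀.1 h.symm).resolve_left (mt Circle.coe_eq_one.1 hz)

theorem integrable_circle_mul {X : Type*} [TopologicalSpace X] [MeasurableSpace X]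
    [OpensMeasurableSpace X] {ν : Measure X} {c : X → Circle} {f : X → ℂ} (hc : Continuous c)
    (hf : Integrable f ν) : Integrable (fun x => (c x : ℂ) * f x) ν :=
  hf.bdd_mul (c := 1) (by fun_prop : Continuous fun x => (c x : ℂ)).aestronglyMeasurable
    (.of_forall fun _ => (Circle.norm_coe _).le)

namespace IsSelfDualPairing

variable {E : Type*} [NormedAddCommGroup E] {q : ℝ} {e : E → E → Circle}

theorem map_add_left (he : IsSelfDualPairing q e) (x y z : E) : e (x + y) z = e x z * e y z := by
  simp only [he.symm _ z, he.map_add_right]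

theorem map_sub_left (he : IsSelfDualPairing q e) (x y z : E) :
    e (x - y) z = (e y z)⁻¹ * e x z := by
  rw [eq_inv_mul_iff_mul_eq, ← he.map_add_left, add_sub_cancel]

theorem continuous (he : IsSelfDualPairing q e) : Continuous fun p : E × E => e p.1 p.2 := by
  refine IsLocallyConstant.continuous ((IsLocallyConstant.iff_eventually_eq _).2 fun ⟨x, y⟩ => ?_)
  have hright : ∀ᶠ p : E × E in nhds (x, y), ‖x‖ * ‖p.2 - y‖ < 1 :=
    Continuous.tendsto' (by fun_prop) _ _ (by simp) |>.eventually_lt_const zero_lt_one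
  have hleft : ∀ᶠ p : E × E in nhds (x, y), ‖p.1 - x‖ * ‖p.2‖ < 1 :=
    Continuous.tendsto' (by fun_prop) _ _ (by simp) |>.eventually_lt_const zero_lt_one
  filter_upwards [hright, hleft] with p h₁ h₂
  calc e p.1 p.2 = e x (y + (p.2 - y)) * e (p.1 - x) p.2 := by
        rw [add_sub_cancel, ← he.map_add_left, add_sub_cancel]
    _ = e x y := by
        rw [he.map_add_right, he.eq_one _ _ h₁.le, he.eq_one _ _ h₂.le, mul_one, mul_one]

variable [MeasurableSpace E] [BorelSpace E] [ProperSpace E] [IsUltrametricDist E] {μ : Measure E}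
  [μ.IsAddHaarMeasure]

theorem ballAvg_zero (he : IsSelfDualPairing q e) (hq : 0 < q) (x : E) (m : ℤ) :
    ballAvg μ (q ^ m) (fun y => (e x y : ℂ)) 0 = if ‖x‖ ≤ q ^ (-m) then 1 else 0 := by
  have hqm : 0 < q ^ m := zpow_pos hq m
  have hle : ‖x‖ ≤ q ^ (-m) ↔ ‖x‖ * q ^ m ≤ 1 := by
    rw [zpow_neg, ← one_div, le_div_iff₀ hqm]
  split_ifs with hx
  · rw [← ballAvg_const (μ := μ) hqm (1 : ℂ) (0 : E)]
    refine ballAvg_congr fun y hy => ?_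
    rw [he.eq_one, Circle.coe_one]
    exact (mul_le_mul_of_nonneg_left (by simpa using hy) (norm_nonneg x)).trans (hle.1 hx)
  · obtain ⟨h, hh, hne⟩ := he.exists_ne_one x m (not_le.1 (mt hle.2 hx))
    have hinv : ballAvg μ (q ^ m) (fun y => (e x y : ℂ)) h =
        e x h * ballAvg μ (q ^ m) (fun y => (e x y : ℂ)) 0 := by
      rw [ballAvg_eq_setAverage_add]
      simp only [he.map_add_right, Circle.coe_mul]
      exact integral_const_mul _ _
    rw [isConstOnBalls_ballAvg μ (q ^ m) _ (by simpa using hh : dist h 0 ≤ q ^ m)] at hinv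
    exact eq_zero_of_eq_mul hne hinv

end IsSelfDualPairing

section Fourier

variable {E : Type*} [NormedAddCommGroup E] [MeasurableSpace E] {μ : Measure E} {q : ℝ} {n : ℕ}
  {e : E → E → Circle} {f : E → ℂ} {J : ℕ}

/-- The Fourier transform with respect to the pairing `e`. -/
noncomputable def pairingFourier (μ : Measure E) (e : E → E → Circle) (f : E → ℂ) (ξ : E) : ℂ :=
  ∫ x, (e x ξ : ℂ) * f x ∂μ

/-- The pseudo-differential operator with symbol `σ ‖ξ‖` with respect to the pairing `e`. -/
noncomputable def symbolOp (μ : Measure E) (e : E → E → Circle) (σ : ℝ → ℂ) (f : E → ℂ) (x : E) :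
    ℂ :=
  ∫ ξ, ((e x ξ)⁻¹ : Circle) * (σ ‖ξ‖ * pairingFourier μ e f ξ) ∂μ

theorem pairingFourier_eq_zero_of_norm_le (he : IsSelfDualPairing q e) (hq : 0 < q)
    (hsupp : ∀ x, f x ≠ 0 → ‖x‖ ≤ q ^ (J : ℤ)) (hf : ∫ x, f x ∂μ = 0) {ξ : E}
    (hξ : ‖ξ‖ ≤ q ^ (-(J : ℤ))) : pairingFourier μ e f ξ = 0 := by
  rw [← hf]
  refine integral_congr_ae (.of_forall fun x => ?_)
  by_cases hx : f x = 0
  · simp [hx]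
  · have h : ‖x‖ * ‖ξ‖ ≤ 1 := by
      calc ‖x‖ * ‖ξ‖ ≤ q ^ (J : ℤ) * q ^ (-(J : ℤ)) := by gcongr; exact hsupp x hx
        _ = 1 := by rw [← zpow_add₀ hq.ne', add_neg_cancel, zpow_zero]
    simp [he.eq_one x ξ h]

theorem isConstOnBalls_pairingFourier (he : IsSelfDualPairing q e) (hq : 0 < q)
    (hsupp : ∀ x, f x ≠ 0 → ‖x‖ ≤ q ^ (J : ℤ)) :
    IsConstOnBalls (q ^ (-(J : ℤ))) (pairingFourier μ e f) := by
  intro ξ η hξη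
  refine integral_congr_ae (.of_forall fun x => ?_)
  by_cases hx : f x = 0
  · simp [hx]
  · have h : ‖x‖ * ‖ξ - η‖ ≤ 1 := by
      calc ‖x‖ * ‖ξ - η‖ ≤ q ^ (J : ℤ) * q ^ (-(J : ℤ)) := by
            gcongr
            exacts [hsupp x hx, by rwa [← dist_eq_norm]]
        _ = 1 := by rw [← zpow_add₀ hq.ne', add_neg_cancel, zpow_zero]
    have hexp : e x ξ = e x η := by
      rw [← sub_add_cancel ξ η, he.map_add_right, he.eq_one x _ h, one_mul]
    simp only [hexp]

theorem pairingFourier_eq_zero_of_lt_norm [BorelSpace E] [μ.IsAddHaarMeasure]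
    (he : IsSelfDualPairing q e) (hq : 0 < q) (hf : IsConstOnBalls (q ^ (-(J : ℤ))) f) {ξ : E}
    (hξ : q ^ (J : ℤ) < ‖ξ‖) : pairingFourier μ e f ξ = 0 := by
  obtain ⟨h, hh, hne⟩ := he.exists_ne_one ξ (-(J : ℤ)) (by
    rwa [zpow_neg, ← div_eq_mul_inv, one_lt_div (zpow_pos hq _)])
  refine eq_zero_of_eq_mul (he.symm ξ h ▸ hne) ?_
  calc pairingFourier μ e f ξ = ∫ x, (e (x + h) ξ : ℂ) * f (x + h) ∂μ :=
        (integral_add_right_eq_self (fun x => (e x ξ : ℂ) * f x) h).symm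
    _ = ∫ x, e h ξ * (e x ξ * f x) ∂μ := by
        refine integral_congr_ae (.of_forall fun x => ?_)
        dsimp only
        rw [he.map_add_left, hf (by simpa using hh : dist (x + h) x ≤ _), Circle.coe_mul]
        ring
    _ = e h ξ * pairingFourier μ e f ξ := integral_const_mul _ _

theorem isTest_pairingFourier [ProperSpace E] [BorelSpace E]
    [μ.IsAddHaarMeasure] (he : IsSelfDualPairing q e) (hq : 0 < q)
    (hconst : IsConstOnBalls (q ^ (-(J : ℤ))) f) (hsupp : ∀ x, f x ≠ 0 → ‖x‖ ≤ q ^ (J : ℤ)) :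
    IsTest (pairingFourier μ e f) :=
  (isConstOnBalls_pairingFourier he hq hsupp).isTest (zpow_pos hq _) fun _ hξ =>
    le_of_not_gt fun h => hξ (pairingFourier_eq_zero_of_lt_norm he hq hconst h)

/-- A function of the norm is constant on the shells `‖ξ‖ = q ^ j`, which are differences of
consecutive balls. -/
theorem mul_eq_sum_indicator_sub_indicator (hμ : IsNormalizedHaar μ q n) (σ : ℝ → ℂ) {g : E → ℂ}
    (hle : ∀ ξ, ‖ξ‖ ≤ q ^ (-(J : ℤ)) → g ξ = 0) (hlt : ∀ ξ, q ^ (J : ℤ) < ‖ξ‖ → g ξ = 0) (ξ : E) :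
    σ ‖ξ‖ * g ξ = ∑ j ∈ Finset.Ioc (-(J : ℤ)) J, σ (q ^ j) *
      ((Metric.closedBall 0 (q ^ j)).indicator g ξ -
        (Metric.closedBall 0 (q ^ (j - 1))).indicator g ξ) := by
  classical
  by_cases hg : g ξ = 0
  · simp [Set.indicator_apply, hg]
  have hlo : q ^ (-(J : ℤ)) < ‖ξ‖ := lt_of_not_ge (mt (hle ξ) hg)
  have hhi : ‖ξ‖ ≤ q ^ (J : ℤ) := le_of_not_gt (mt (hlt ξ) hg)
  obtain ⟨k, hk⟩ := hμ.norm_eq_zpow ξ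
    (norm_pos_iff.1 ((zpow_pos (zero_lt_one.trans hμ.one_lt) _).trans hlo))
  rw [hk, zpow_lt_zpow_iff_right₀ hμ.one_lt] at hlo
  rw [hk, zpow_le_zpow_iff_right₀ hμ.one_lt] at hhi
  rw [Finset.sum_eq_single k]
  · simp [hk, zpow_le_zpow_iff_right₀ hμ.one_lt]
  · intro j _ hj
    have hkj : k ≤ j ↔ k ≤ j - 1 := by omega
    simp [Set.indicator_apply, hk, zpow_le_zpow_iff_right₀ hμ.one_lt, hkj]
  · exact fun h => absurd (Finset.mem_Ioc.2 ⟨hlo, hhi⟩) h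

variable [BorelSpace E] [ProperSpace E] [IsUltrametricDist E] [μ.IsAddHaarMeasure]

theorem setIntegral_pairing (he : IsSelfDualPairing q e) (hμ : IsNormalizedHaar μ q n) (m : ℤ)
    (z : E) : ∫ ξ in Metric.closedBall 0 (q ^ m), (e z ξ : ℂ) ∂μ =
      if ‖z‖ ≤ q ^ (-m) then (((q ^ m) ^ n : ℝ) : ℂ) else 0 := by
  rw [← measure_smul_setAverage _ measure_closedBall_lt_top.ne, hμ.measureReal_closedBall]
  have h := he.ballAvg_zero (μ := μ) (zero_lt_one.trans hμ.one_lt) z m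
  rw [ballAvg] at h
  rw [h]
  split_ifs <;> simp

theorem setIntegral_inv_pairing_mul_pairingFourier (he : IsSelfDualPairing q e)
    (hμ : IsNormalizedHaar μ q n) (hf : Integrable f μ) (m : ℤ) (x : E) :
    ∫ ξ in Metric.closedBall 0 (q ^ m), ((e x ξ)⁻¹ : Circle) * pairingFourier μ e f ξ ∂μ =
      lowPass μ q m f x := by
  set B := Metric.closedBall (0 : E) (q ^ m)
  have : IsFiniteMeasure (μ.restrict B) := ⟨by simpa using measure_closedBall_lt_top⟩
  have hint : Integrable (fun p : E × E => (e (p.2 - x) p.1 : ℂ) * f p.2) ((μ.restrict B).prod μ) :=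
    integrable_circle_mul (he.continuous.comp (by fun_prop : Continuous fun p : E × E =>
      (p.2 - x, p.1))) (hf.comp_snd _)
  calc ∫ ξ in B, ((e x ξ)⁻¹ : Circle) * pairingFourier μ e f ξ ∂μ
      = ∫ ξ in B, ∫ y, (e (y - x) ξ : ℂ) * f y ∂μ ∂μ := by
        simp only [pairingFourier, ← integral_const_mul, ← mul_assoc, he.map_sub_left,
          Circle.coe_mul]
    _ = ∫ y, (∫ ξ in B, (e (y - x) ξ : ℂ) ∂μ) * f y ∂μ := by
        rw [integral_integral_swap hint]
        simp only [integral_mul_const]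
    _ = ∫ y, (Metric.closedBall x (q ^ (-m))).indicator (fun y => ((q ^ m) ^ n : ℝ) * f y) y
        ∂μ := by
        classical
        simp only [B, setIntegral_pairing he hμ, ← dist_eq_norm, Set.indicator_apply,
          Metric.mem_closedBall, ite_mul, zero_mul]
    _ = lowPass μ q m f x := by
        rw [integral_indicator Metric.isClosed_closedBall.measurableSet, integral_const_mul,
          lowPass, ballAvg, setAverage_eq, Measure.addHaar_real_closedBall_center,
          hμ.measureReal_closedBall, zpow_neg, inv_pow, inv_inv, Complex.real_smul]

theorem symbolOp_eq_multiplier (he : IsSelfDualPairing q e) (hμ : IsNormalizedHaar μ q n)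
    (hf : IsMeanZeroTest μ f) (σ : ℝ → ℂ) :
    symbolOp μ e σ f = multiplier μ q (fun j => σ (q ^ j)) f := by
  have hq : 0 < q := zero_lt_one.trans hμ.one_lt
  obtain ⟨J, hconst, hsupp⟩ := hf.exists_isConstOnBalls_zpow hμ.one_lt
  rw [(hf.hasBand hμ.one_lt hconst hsupp).multiplier_eq_sum]
  ext x
  set g : E → ℂ := fun ξ => ((e x ξ)⁻¹ : Circle) * pairingFourier μ e f ξ
  have hg : Integrable g μ :=
    integrable_circle_mul (he.continuous.comp (by fun_prop : Continuous fun ξ => (x, ξ))).inv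
      (isTest_pairingFourier he hq hconst hsupp).integrable
  have hgB (m : ℤ) : Integrable ((Metric.closedBall 0 (q ^ m)).indicator g) μ :=
    hg.indicator Metric.isClosed_closedBall.measurableSet
  have hgB_integral (m : ℤ) :
      ∫ ξ, (Metric.closedBall 0 (q ^ m)).indicator g ξ ∂μ = lowPass μ q m f x := by
    rw [integral_indicator Metric.isClosed_closedBall.measurableSet]
    exact setIntegral_inv_pairing_mul_pairingFourier he hμ hf.integrable m x
  have hshell (ξ : E) := mul_eq_sum_indicator_sub_indicator (J := J) hμ σ (g := g)
    (fun ξ hξ => mul_eq_zero_of_right _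
      (pairingFourier_eq_zero_of_norm_le he hq hsupp hf.integral_eq_zero hξ))
    (fun ξ hξ => mul_eq_zero_of_right _ (pairingFourier_eq_zero_of_lt_norm he hq hconst hξ)) ξ
  calc symbolOp μ e σ f x = ∫ ξ, σ ‖ξ‖ * g ξ ∂μ := by
        simp only [symbolOp, g, mul_left_comm]
    _ = ∑ j ∈ Finset.Ioc (-(J : ℤ)) J, σ (q ^ j) * bandPass μ q j f x := by
        simp only [hshell]
        rw [integral_finsetSum _ fun j _ => by exact ((hgB j).sub (hgB (j - 1))).const_mul _]
        simp only [integral_const_mul, integral_sub (hgB _) (hgB _), hgB_integral, bandPass]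

end Fourier

/-! ### Estimates in `L_p` -/

section RealInequalities

theorem mul_rpow_sub_one_le {p a b : ℝ} (hp : 1 < p) (ha : 0 ≤ a) (hb : 0 ≤ b) :
    p * (a * b ^ (p - 1)) ≤ a ^ p + (p - 1) * b ^ p := by
  have hp1 : p - 1 ≠ 0 := by linarith
  have hyoung := Real.young_inequality_of_nonneg ha (Real.rpow_nonneg hb (p - 1))
    (Real.HolderConjugate.conjExponent hp)
  rw [← Real.rpow_mul hb, Real.conjExponent, mul_div_cancel₀ _ hp1] at hyoung
  calc p * (a * b ^ (p - 1)) ≤ p * (a ^ p / p + b ^ p / (p / (p - 1))) := by gcongr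
    _ = a ^ p + (p - 1) * b ^ p := by field_simp

theorem max_rpow_le {p b c : ℝ} (hp : 1 < p) (hb : 0 ≤ b) (hc : 0 ≤ c) :
    max b c ^ p ≤ b ^ p + p / (p - 1) * ((max b c ^ (p - 1) - b ^ (p - 1)) * c) := by
  rcases le_total c b with h | h
  · simp [max_eq_left h]
  · have hyoung := mul_rpow_sub_one_le hp hc hb
    have hmul : c ^ (p - 1) * c = c ^ p := by
      rw [← Real.rpow_add_one' hc (by linarith), sub_add_cancel]
    rw [max_eq_right h, sub_mul, hmul, ← sub_le_iff_le_add', div_mul_eq_mul_div,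
      le_div_iff₀ (by linarith)]
    linarith

theorem mul_rpow_sub_one_le_half {p a b : ℝ} (hp : 1 < p) (ha : 0 ≤ a) (hb : 0 ≤ b) :
    p / (p - 1) * (b ^ (p - 1) * a) ≤ 2 ^ p / (2 * (p - 1)) * a ^ p + 1 / 2 * b ^ p := by
  have hp1 : 0 < p - 1 := by linarith
  have h := mul_rpow_sub_one_le hp (mul_nonneg zero_le_two ha) hb
  rw [Real.mul_rpow zero_le_two ha] at h
  calc p / (p - 1) * (b ^ (p - 1) * a) = 1 / (2 * (p - 1)) * (p * (2 * a * b ^ (p - 1))) := by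
        field_simp
    _ ≤ 1 / (2 * (p - 1)) * (2 ^ p * a ^ p + (p - 1) * b ^ p) := by gcongr
    _ = 2 ^ p / (2 * (p - 1)) * a ^ p + 1 / 2 * b ^ p := by field_simp

variable {Q ε : ℝ}

theorem summable_rpow_neg_abs (hQ : 1 < Q) (hε : 0 < ε) :
    Summable fun i : ℤ => Q ^ (-(ε * |(i : ℝ)|)) := by
  have hQ0 : 0 ≤ Q := by linarith
  have hgeom : Summable fun l : ℕ => Q ^ (-(ε * |((l : ℤ) : ℝ)|)) := by
    refine (summable_geometric_of_lt_one (Real.rpow_nonneg hQ0 (-ε))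
      (Real.rpow_lt_one_of_one_lt_of_neg hQ (by linarith))).congr fun l => ?_
    rw [← Real.rpow_mul_natCast hQ0, Int.cast_natCast, Nat.abs_cast, neg_mul]
  exact .of_nat_of_neg hgeom (by simpa using hgeom)

theorem sum_rpow_neg_abs_sub_le (hQ : 1 < Q) (hε : 0 < ε) (s : Finset ℤ) (L : ℝ) :
    ∑ j ∈ s, Q ^ (-(ε * |j - L|)) ≤ Q ^ ε * ∑' i : ℤ, Q ^ (-(ε * |(i : ℝ)|)) := by
  have hQ0 : 0 < Q := by linarith
  have hsum := (Equiv.subRight ⌊L⌋).summable_iff.2 (summable_rpow_neg_abs hQ hε)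
  have hshift (j : ℤ) : Q ^ (-(ε * |j - L|)) ≤ Q ^ ε * Q ^ (-(ε * |((j - ⌊L⌋ : ℤ) : ℝ)|)) := by
    rw [← Real.rpow_add hQ0]
    refine Real.rpow_le_rpow_of_exponent_le hQ.le ?_
    have htri : |(j : ℝ) - ⌊L⌋| ≤ |j - L| + |L - ⌊L⌋| := abs_sub_le _ _ _
    have hfract : |L - ⌊L⌋| ≤ 1 := by
      rw [Int.self_sub_floor, abs_of_nonneg (Int.fract_nonneg L)]
      exact (Int.fract_lt_one L).le
    push_cast
    nlinarith
  calc ∑ j ∈ s, Q ^ (-(ε * |j - L|))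
      ≤ Q ^ ε * ∑ j ∈ s, Q ^ (-(ε * |((j - ⌊L⌋ : ℤ) : ℝ)|)) := by
        rw [Finset.mul_sum]
        exact Finset.sum_le_sum fun j _ => hshift j
    _ ≤ Q ^ ε * ∑' i : ℤ, Q ^ (-(ε * |(i : ℝ)|)) := by
        rw [← (Equiv.subRight ⌊L⌋).tsum_eq]
        gcongr
        exact hsum.sum_le_tsum s fun j _ => Real.rpow_nonneg hQ0.le _

theorem rpow_mul_min_one_le (hQ : 1 ≤ Q) (β δ u : ℝ) :
    Q ^ (-(β * u)) * min 1 (Q ^ (δ * u)) ≤ Q ^ (-(min β (δ - β) * |u|)) := by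
  have hQ0 : 0 < Q := by linarith
  rcases le_total 0 u with hu | hu
  · calc Q ^ (-(β * u)) * min 1 (Q ^ (δ * u)) ≤ Q ^ (-(β * u)) * 1 := by
          gcongr
          exact min_le_left _ _
      _ ≤ Q ^ (-(min β (δ - β) * |u|)) := by
          rw [mul_one, abs_of_nonneg hu]
          gcongr
          exact min_le_left _ _
  · calc Q ^ (-(β * u)) * min 1 (Q ^ (δ * u)) ≤ Q ^ (-(β * u)) * Q ^ (δ * u) := by
          gcongr
          exact min_le_right _ _
      _ ≤ Q ^ (-(min β (δ - β) * |u|)) := by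
          rw [← Real.rpow_add hQ0, abs_of_nonpos hu]
          refine Real.rpow_le_rpow_of_exponent_le hQ ?_
          nlinarith [min_le_right β (δ - β)]

theorem exists_sum_rpow_mul_min_le {β δ : ℝ} (hQ : 1 < Q) (hβ : 0 < β) (hδ : β < δ) :
    ∃ C : ℝ, 0 ≤ C ∧ ∀ (s : Finset ℤ) (M N : ℝ), 0 ≤ M → 0 ≤ N →
      ∑ j ∈ s, Q ^ (-(β * j)) * min M (Q ^ (δ * j) * N) ≤ C * (M ^ (1 - β / δ) * N ^ (β / δ)) := by
  have hQ0 : 0 < Q := by linarith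
  have hδ0 : 0 < δ := by linarith
  have hθ : 0 < 1 - β / δ := by rwa [sub_pos, div_lt_one hδ0]
  set ε := min β (δ - β)
  have hε : 0 < ε := lt_min hβ (by linarith)
  refine ⟨Q ^ ε * ∑' i : ℤ, Q ^ (-(ε * |(i : ℝ)|)), by positivity, fun s M N hM hN => ?_⟩
  rcases hM.eq_or_lt with rfl | hM
  · simp [min_eq_left (mul_nonneg (Real.rpow_nonneg hQ0.le _) hN), Real.zero_rpow hθ.ne']
  rcases hN.eq_or_lt with rfl | hN
  · simp [min_eq_right hM.le, Real.zero_rpow (div_pos hβ hδ0).ne']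
  -- The two progressions cross at `j = L`.
  obtain ⟨L, rfl⟩ : ∃ L, M = N * Q ^ (δ * L) := by
    refine ⟨Real.logb Q (M / N) / δ, ?_⟩
    rw [mul_div_cancel₀ _ hδ0.ne', Real.rpow_logb hQ0 hQ.ne' (by positivity)]
    field_simp
  have hpeak : (N * Q ^ (δ * L)) ^ (1 - β / δ) * N ^ (β / δ) = N * Q ^ ((δ - β) * L) := by
    rw [Real.mul_rpow hN.le (by positivity), mul_right_comm, ← Real.rpow_add hN,
      ← Real.rpow_mul hQ0.le, sub_add_cancel, Real.rpow_one]
    congr 2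
    field_simp
  have hterm (j : ℤ) : Q ^ (-(β * j)) * min (N * Q ^ (δ * L)) (Q ^ (δ * j) * N) =
      Q ^ (-(β * (j - L))) * min 1 (Q ^ (δ * (j - L))) * (N * Q ^ ((δ - β) * L)) := by
    have hmin : min (N * Q ^ (δ * L)) (Q ^ (δ * j) * N) =
        N * Q ^ (δ * L) * min 1 (Q ^ (δ * (j - L))) := by
      rw [mul_min_of_nonneg _ _ (by positivity), mul_one, mul_assoc, ← Real.rpow_add hQ0,
        mul_comm _ N]
      ring_nf
    have hexp : Q ^ (-(β * j)) * Q ^ (δ * L) = Q ^ (-(β * (j - L))) * Q ^ ((δ - β) * L) := by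
      rw [← Real.rpow_add hQ0, ← Real.rpow_add hQ0]
      ring_nf
    rw [hmin]
    linear_combination N * min 1 (Q ^ (δ * (j - L))) * hexp
  rw [hpeak, Finset.sum_congr rfl fun j _ => hterm j, ← Finset.sum_mul]
  gcongr
  exact (Finset.sum_le_sum fun j _ => rpow_mul_min_one_le hQ.le β δ _).trans
    (sum_rpow_neg_abs_sub_le hQ hε s L)

end RealInequalities

section Contraction

variable {E W : Type*} [NormedAddCommGroup W]

protected theorem IsTest.rpow [TopologicalSpace E] {g : E → ℝ} (hg : IsTest g) {p : ℝ}
    (hp : p ≠ 0) : IsTest fun x => g x ^ p :=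
  hg.comp (u := (· ^ p)) (Real.zero_rpow hp)

protected theorem IsTest.norm [TopologicalSpace E] {f : E → W} (hf : IsTest f) :
    IsTest fun x => ‖f x‖ :=
  hf.comp norm_zero

variable [MeasurableSpace E]

theorem ballAvg_nonneg [PseudoMetricSpace E] (μ : Measure E) (r : ℝ) {g : E → ℝ}
    (hg : ∀ x, 0 ≤ g x) (x : E) : 0 ≤ ballAvg μ r g x :=
  integral_nonneg hg

theorem norm_ballAvg_le [PseudoMetricSpace E] [NormedSpace ℝ W] (μ : Measure E) (r : ℝ)
    (f : E → W) (x : E) : ‖ballAvg μ r f x‖ ≤ ballAvg μ r (fun y => ‖f y‖) x :=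
  norm_integral_le_integral_norm f

theorem IsTest.eLpNorm_eq [TopologicalSpace E] [OpensMeasurableSpace E] {μ : Measure E}
    [IsFiniteMeasureOnCompacts μ] {f : E → W} (hf : IsTest f) {p : ℝ} (hp : 0 < p) :
    eLpNorm f (ENNReal.ofReal p) μ = ENNReal.ofReal ((∫ x, ‖f x‖ ^ p ∂μ) ^ p⁻¹) := by
  rw [MemLp.eLpNorm_eq_integral_rpow_norm (ENNReal.ofReal_ne_zero_iff.2 hp) ENNReal.ofReal_ne_top
    (hf.continuous.memLp_of_hasCompactSupport hf.hasCompactSupport), ENNReal.toReal_ofReal hp.le]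

theorem IsTest.norm_rpow_ballAvg_le [PseudoMetricSpace E] [OpensMeasurableSpace E] [ProperSpace E]
    {μ : Measure E} [IsFiniteMeasureOnCompacts μ] [μ.IsOpenPosMeasure] [NormedSpace ℝ W]
    {f : E → W} (hf : IsTest f) {r p : ℝ} (hr : 0 < r) (hp : 1 ≤ p) (x : E) :
    ‖ballAvg μ r f x‖ ^ p ≤ ballAvg μ r (fun y => ‖f y‖ ^ p) x := by
  have hp0 : p ≠ 0 := by linarith
  calc ‖ballAvg μ r f x‖ ^ p ≤ ballAvg μ r (fun y => ‖f y‖) x ^ p := by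
        gcongr
        exact norm_ballAvg_le μ r f x
    _ ≤ ballAvg μ r (fun y => ‖f y‖ ^ p) x :=
        (convexOn_rpow hp).map_set_average_le
          (Real.continuous_rpow_const (by linarith)).continuousOn isClosed_Ici
          (Metric.measure_closedBall_pos μ x hr).ne' measure_closedBall_lt_top.ne
          (.of_forall fun y => norm_nonneg (f y)) hf.norm.integrable.integrableOn
          (hf.norm.rpow hp0).integrable.integrableOn

theorem IsTest.eLpNorm_ballAvg_le [NormedAddCommGroup E] [IsUltrametricDist E] [ProperSpace E]
    [BorelSpace E] {μ : Measure E} [μ.IsAddHaarMeasure] [NormedSpace ℝ W] {f : E → W}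
    (hf : IsTest f) {r p : ℝ} (hr : 0 < r) (hp : 1 ≤ p) :
    eLpNorm (ballAvg μ r f) (ENNReal.ofReal p) μ ≤ eLpNorm f (ENNReal.ofReal p) μ := by
  have hp0 : 0 < p := by linarith
  have hfp : IsTest fun x => ‖f x‖ ^ p := hf.norm.rpow hp0.ne'
  have hAvg : IsTest (ballAvg μ r f) := hf.ballAvg hr
  rw [hf.eLpNorm_eq hp0, hAvg.eLpNorm_eq hp0]
  gcongr ENNReal.ofReal (?_ ^ p⁻¹)
  calc ∫ x, ‖ballAvg μ r f x‖ ^ p ∂μ ≤ ∫ x, ballAvg μ r (fun y => ‖f y‖ ^ p) x ∂μ :=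
        integral_mono (hAvg.norm.rpow hp0.ne').integrable (hfp.ballAvg hr).integrable
          (hf.norm_rpow_ballAvg_le hr hp)
    _ = ∫ x, ‖f x‖ ^ p ∂μ := integral_ballAvg hr hfp.integrable

end Contraction

section MaximalFunction

variable {E : Type*} [MeasurableSpace E] {r : ℕ → ℝ} {g : E → ℝ} {p : ℝ}

/-- The maximal function of `g` over the first `k` of the balls of radii `r 0`, `r 1`, …. Starting
from `0` instead of a first average makes no difference for nonnegative `g`. -/
noncomputable def maximalAvg [PseudoMetricSpace E] (μ : Measure E) (r : ℕ → ℝ) (g : E → ℝ) :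
    ℕ → E → ℝ
  | 0 => 0
  | k + 1 => fun x => max (maximalAvg μ r g k x) (ballAvg μ (r k) g x)

theorem maximalAvg_nonneg [PseudoMetricSpace E] (μ : Measure E) (r : ℕ → ℝ) (g : E → ℝ) (k : ℕ)
    (x : E) : 0 ≤ maximalAvg μ r g k x := by
  induction k with
  | zero => exact le_rfl
  | succ k ih => exact ih.trans (le_max_left _ _)

theorem ballAvg_le_maximalAvg [PseudoMetricSpace E] (μ : Measure E) (r : ℕ → ℝ) (g : E → ℝ)
    {i k : ℕ} (hi : i < k) (x : E) : ballAvg μ (r i) g x ≤ maximalAvg μ r g k x := by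
  induction k, Nat.succ_le_of_lt hi using Nat.le_induction with
  | base => exact le_max_right _ _
  | succ k hk ih => exact (ih hk).trans (le_max_left _ _)

theorem isConstOnBalls_maximalAvg [PseudoMetricSpace E] [IsUltrametricDist E] (μ : Measure E)
    (hr : Antitone r) (g : E → ℝ) {j k : ℕ} (hk : k ≤ j + 1) :
    IsConstOnBalls (r j) (maximalAvg μ r g k) := by
  induction k with
  | zero => exact fun _ _ _ => rfl
  | succ k ih =>
    exact (ih (by omega)).comp₂ ((isConstOnBalls_ballAvg μ (r k) g).mono (hr (by omega))) max

protected theorem IsTest.maximalAvg [NormedAddCommGroup E] [IsUltrametricDist E] [ProperSpace E]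
    [OpensMeasurableSpace E] {μ : Measure E} (hr : ∀ i, 0 < r i) (hg : IsTest g) (k : ℕ) :
    IsTest (maximalAvg μ r g k) := by
  induction k with
  | zero => exact ⟨.const 0, .zero⟩
  | succ k ih => exact ih.comp₂ (hg.ballAvg (hr k)) (max_self 0)

variable [NormedAddCommGroup E] [IsUltrametricDist E] [ProperSpace E] [BorelSpace E]
  {μ : Measure E} [μ.IsAddHaarMeasure]

theorem integral_maximalAvg_succ_rpow_le (hr : Antitone r) (hr0 : ∀ i, 0 < r i) (hg : IsTest g)
    (hg0 : ∀ x, 0 ≤ g x) (hp : 1 < p) (k : ℕ) :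
    ∫ x, maximalAvg μ r g (k + 1) x ^ p ∂μ ≤ ∫ x, maximalAvg μ r g k x ^ p ∂μ +
      p / (p - 1) * ∫ x, (maximalAvg μ r g (k + 1) x ^ (p - 1) -
        maximalAvg μ r g k x ^ (p - 1)) * g x ∂μ := by
  set h : E → ℝ := fun x =>
    maximalAvg μ r g (k + 1) x ^ (p - 1) - maximalAvg μ r g k x ^ (p - 1)
  have hM : ∀ k, IsTest (maximalAvg μ r g k) := hg.maximalAvg hr0
  have hp1 : p - 1 ≠ 0 := by linarith
  have hh : IsTest h := ((hM (k + 1)).rpow hp1).comp₂ ((hM k).rpow hp1) (sub_zero 0)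
  have hconst : IsConstOnBalls (r k) h :=
    (isConstOnBalls_maximalAvg μ hr g le_rfl).comp₂ (isConstOnBalls_maximalAvg μ hr g (by omega))
      fun a b => a ^ (p - 1) - b ^ (p - 1)
  have hMp (k : ℕ) : Integrable (fun x => maximalAvg μ r g k x ^ p) μ :=
    ((hM k).rpow (by linarith)).integrable
  have hhg : Integrable (fun x => p / (p - 1) * (h x * ballAvg μ (r k) g x)) μ :=
    (hh.comp₂ (hg.ballAvg (hr0 k)) (mul_zero 0)).integrable.const_mul _
  calc ∫ x, maximalAvg μ r g (k + 1) x ^ p ∂μ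
      ≤ ∫ x, (maximalAvg μ r g k x ^ p + p / (p - 1) * (h x * ballAvg μ (r k) g x)) ∂μ := by
        exact integral_mono (hMp _) ((hMp k).add hhg) fun x =>
          max_rpow_le hp (maximalAvg_nonneg μ r g k x) (ballAvg_nonneg μ (r k) hg0 x)
    _ = ∫ x, maximalAvg μ r g k x ^ p ∂μ + p / (p - 1) * ∫ x, h x * g x ∂μ := by
        rw [integral_add (hMp k) hhg, integral_const_mul]
        congr 2
        exact integral_smul_ballAvg (hr0 k) hconst (hh.comp₂ hg (mul_zero 0)).integrable

theorem integral_maximalAvg_rpow_le (hr : Antitone r) (hr0 : ∀ i, 0 < r i) (hg : IsTest g)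
    (hg0 : ∀ x, 0 ≤ g x) (hp : 1 < p) (k : ℕ) :
    ∫ x, maximalAvg μ r g k x ^ p ∂μ ≤
      p / (p - 1) * ∫ x, maximalAvg μ r g k x ^ (p - 1) * g x ∂μ := by
  have hp1 : p - 1 ≠ 0 := by linarith
  have hgM (k : ℕ) : Integrable (fun x => maximalAvg μ r g k x ^ (p - 1) * g x) μ :=
    (((hg.maximalAvg hr0 k).rpow hp1).comp₂ hg (mul_zero 0)).integrable
  induction k with
  | zero => simp [maximalAvg, Real.zero_rpow hp1, Real.zero_rpow (by linarith : p ≠ 0)]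
  | succ k ih =>
    have hstep := integral_maximalAvg_succ_rpow_le (μ := μ) hr hr0 hg hg0 hp k
    simp only [sub_mul] at hstep
    rw [integral_sub (hgM (k + 1)) (hgM k), mul_sub] at hstep
    linarith

theorem integral_maximalAvg_rpow_le_integral_rpow (hr : Antitone r) (hr0 : ∀ i, 0 < r i)
    (hg : IsTest g) (hg0 : ∀ x, 0 ≤ g x) (hp : 1 < p) (k : ℕ) :
    ∫ x, maximalAvg μ r g k x ^ p ∂μ ≤ 2 ^ p / (p - 1) * ∫ x, g x ^ p ∂μ := by
  have hp0 : p ≠ 0 := by linarith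
  have hp1 : p - 1 ≠ 0 := by linarith
  have hM : IsTest (maximalAvg μ r g k) := hg.maximalAvg hr0 k
  have hgp := (hg.rpow hp0).integrable (μ := μ)
  have hMp := (hM.rpow hp0).integrable (μ := μ)
  have hyoung : p / (p - 1) * ∫ x, maximalAvg μ r g k x ^ (p - 1) * g x ∂μ ≤
      2 ^ p / (2 * (p - 1)) * ∫ x, g x ^ p ∂μ + 1 / 2 * ∫ x, maximalAvg μ r g k x ^ p ∂μ := by
    rw [← integral_const_mul, ← integral_const_mul, ← integral_const_mul,
      ← integral_add (hgp.const_mul _) (hMp.const_mul _)]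
    exact integral_mono (((hM.rpow hp1).comp₂ hg (mul_zero 0)).integrable.const_mul _)
      ((hgp.const_mul _).add (hMp.const_mul _)) fun x =>
      mul_rpow_sub_one_le_half hp (hg0 x) (maximalAvg_nonneg μ r g k x)
  have hhalf : 2 ^ p / (2 * (p - 1)) * ∫ x, g x ^ p ∂μ =
      2 ^ p / (p - 1) * (∫ x, g x ^ p ∂μ) / 2 := by field_simp
  linarith [integral_maximalAvg_rpow_le (μ := μ) hr hr0 hg hg0 hp k]

end MaximalFunction

section Potential

variable {E : Type*} [NormedAddCommGroup E] [MeasurableSpace E] {μ : Measure E} {q : ℝ} {n : ℕ}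

/-- The value of the symbol `‖ξ‖ ^ α` at the frequencies of norm `q ^ j`. -/
noncomputable def powSymbol (q α : ℝ) (j : ℤ) : ℂ :=
  (((q ^ j : ℝ) ^ α : ℝ) : ℂ)

/-- The Riesz potential of order `β`, the operator with symbol `‖ξ‖ ^ (-β)`. -/
noncomputable def rieszPotential (μ : Measure E) (q β : ℝ) (f : E → ℂ) : E → ℂ :=
  multiplier μ q (powSymbol q (-β)) f

theorem eLpNorm_le_of_norm_le_rpow_mul [OpensMeasurableSpace E] [IsFiniteMeasureOnCompacts μ]
    {u f : E → ℂ} {M : E → ℝ} {C D p r θ : ℝ} (hu : IsTest u) (hf : IsTest f) (hM : IsTest M)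
    (hM0 : ∀ x, 0 ≤ M x) (hC : 0 ≤ C) (hD : 0 ≤ D) (hp : 0 < p) (hr : 0 < r)
    (hpr : (1 - θ) * r = p) (hint : ∫ x, M x ^ p ∂μ ≤ D * ∫ x, ‖f x‖ ^ p ∂μ)
    (hle : ∀ x, ‖u x‖ ≤ C * (M x ^ (1 - θ) * ((∫ y, ‖f y‖ ^ p ∂μ) ^ p⁻¹) ^ θ)) :
    eLpNorm u (ENNReal.ofReal r) μ ≤
      ENNReal.ofReal (C * D ^ r⁻¹) * eLpNorm f (ENNReal.ofReal p) μ := by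
  have hS : 0 ≤ ∫ y, ‖f y‖ ^ p ∂μ := integral_nonneg fun x => by positivity
  rw [hu.eLpNorm_eq hr, hf.eLpNorm_eq hp, ← ENNReal.ofReal_mul (by positivity)]
  set N := (∫ y, ‖f y‖ ^ p ∂μ) ^ p⁻¹
  have hN0 : 0 ≤ N := by positivity
  have hNp : N ^ p = ∫ y, ‖f y‖ ^ p ∂μ := Real.rpow_inv_rpow hS hp.ne'
  have hpow (x : E) : ‖u x‖ ^ r ≤ C ^ r * N ^ (θ * r) * M x ^ p := by
    have hMx := hM0 x
    calc ‖u x‖ ^ r ≤ (C * (M x ^ (1 - θ) * N ^ θ)) ^ r := by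
          gcongr
          exact hle x
      _ = C ^ r * N ^ (θ * r) * M x ^ p := by
          rw [Real.mul_rpow hC (by positivity), Real.mul_rpow (by positivity) (by positivity),
            ← Real.rpow_mul hMx, ← Real.rpow_mul hN0, hpr]
          ring
  gcongr
  rw [Real.rpow_inv_le_iff_of_pos (integral_nonneg fun x => by positivity) (by positivity) hr]
  calc ∫ x, ‖u x‖ ^ r ∂μ ≤ C ^ r * N ^ (θ * r) * ∫ x, M x ^ p ∂μ := by
        rw [← integral_const_mul]
        exact integral_mono (hu.norm.rpow hr.ne').integrable
          ((hM.rpow hp.ne').integrable.const_mul _) hpow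
    _ ≤ C ^ r * N ^ (θ * r) * (D * N ^ p) := by
        rw [hNp]
        gcongr
    _ = C ^ r * D * N ^ (θ * r + p) := by
        rw [Real.rpow_add' hN0 (by linarith)]
        ring
    _ = (C * D ^ r⁻¹ * N) ^ r := by
        rw [Real.mul_rpow (by positivity) hN0, Real.mul_rpow hC (by positivity),
          Real.rpow_inv_rpow hD hr.ne', ← hpr]
        ring_nf

theorem IsTest.norm_ballAvg_le_rpow_mul [BorelSpace E] [ProperSpace E] [μ.IsAddHaarMeasure]
    (hμ : IsNormalizedHaar μ q n) {W : Type*} [NormedAddCommGroup W] [NormedSpace ℝ W] {f : E → W}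
    (hf : IsTest f) {p : ℝ} (hp : 1 ≤ p) (j : ℤ) (x : E) :
    ‖ballAvg μ (q ^ (-j)) f x‖ ≤ q ^ (n / p * j) * (∫ y, ‖f y‖ ^ p ∂μ) ^ p⁻¹ := by
  have hq : 0 < q := by linarith [hμ.one_lt]
  have hp0 : 0 < p := by linarith
  have hint := (hf.norm.rpow hp0.ne').integrable (μ := μ)
  have hvol : (μ.real (Metric.closedBall x (q ^ (-j))))⁻¹ = (q ^ (n / p * j)) ^ p := by
    rw [Measure.addHaar_real_closedBall_center, hμ.measureReal_closedBall, ← Real.rpow_mul hq.le,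
      ← zpow_natCast, ← zpow_mul, ← zpow_neg, ← Real.rpow_intCast]
    congr 1
    push_cast
    field_simp
  have hS : 0 ≤ ∫ y, ‖f y‖ ^ p ∂μ := integral_nonneg fun y => by positivity
  refine (Real.rpow_le_rpow_iff (norm_nonneg _) (by positivity) hp0).1 ?_
  calc ‖ballAvg μ (q ^ (-j)) f x‖ ^ p ≤ ballAvg μ (q ^ (-j)) (fun y => ‖f y‖ ^ p) x :=
        hf.norm_rpow_ballAvg_le (zpow_pos hq _) hp x
    _ ≤ (q ^ (n / p * j)) ^ p * ∫ y, ‖f y‖ ^ p ∂μ := by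
        rw [ballAvg, setAverage_eq, hvol, smul_eq_mul]
        gcongr
        · exact .of_forall fun y => by positivity
        · exact Measure.restrict_le_self
    _ = (q ^ (n / p * j) * (∫ y, ‖f y‖ ^ p ∂μ) ^ p⁻¹) ^ p := by
        rw [Real.mul_rpow (by positivity) (by positivity), Real.rpow_inv_rpow hS hp0.ne']

section Haar

variable [BorelSpace E] [ProperSpace E] [μ.IsAddHaarMeasure]

theorem IsMeanZeroTest.norm_rieszPotential_le (hμ : IsNormalizedHaar μ q n) {f : E → ℂ}
    (hf : IsMeanZeroTest μ f) {J : ℕ} (hJ : HasBand μ q J f) (β : ℝ) {p : ℝ} (hp : 1 ≤ p) (x : E) :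
    ‖rieszPotential μ q β f x‖ ≤ 2 * ∑ j ∈ Finset.Ioc (-(J : ℤ)) J, q ^ (-(β * j)) *
      min (maximalAvg μ (fun i => q ^ (J - i : ℤ)) (fun y => ‖f y‖) (2 * J + 1) x)
        (q ^ (n / p * j) * (∫ y, ‖f y‖ ^ p ∂μ) ^ p⁻¹) := by
  have hq : 0 < q := by linarith [hμ.one_lt]
  set M := maximalAvg μ (fun i => q ^ (J - i : ℤ)) (fun y => ‖f y‖) (2 * J + 1) x
  set N := (∫ y, ‖f y‖ ^ p ∂μ) ^ p⁻¹
  have hlow (i j : ℤ) (hi : -J ≤ i) (hij : i ≤ j) (hj : j ≤ J) :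
      ‖lowPass μ q i f x‖ ≤ min M (q ^ (n / p * j) * N) := by
    refine le_min ((norm_ballAvg_le μ _ f x).trans ?_)
      ((hf.norm_ballAvg_le_rpow_mul hμ hp i x).trans ?_)
    · have hle := ballAvg_le_maximalAvg μ (fun i : ℕ => q ^ (J - i : ℤ)) (fun y => ‖f y‖)
        (show (i + J).toNat < 2 * J + 1 by omega) x
      rwa [show (J : ℤ) - (i + J).toNat = -i by omega] at hle
    · gcongr
      exact hμ.one_lt.le
  rw [rieszPotential, hJ.multiplier_eq_sum, Finset.mul_sum]
  refine norm_sum_le_of_le _ fun j hj => ?_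
  rw [Finset.mem_Ioc] at hj
  calc ‖powSymbol q (-β) j * bandPass μ q j f x‖
      = q ^ (-(β * j)) * ‖lowPass μ q j f x - lowPass μ q (j - 1) f x‖ := by
        rw [norm_mul, powSymbol, Complex.norm_real, Real.norm_of_nonneg (by positivity), bandPass,
          ← Real.rpow_intCast, ← Real.rpow_mul hq.le, mul_neg, mul_comm (j : ℝ)]
    _ ≤ q ^ (-(β * j)) * (min M (q ^ (n / p * j) * N) + min M (q ^ (n / p * j) * N)) := by
        gcongr
        exact norm_sub_le_of_le (hlow j j (by omega) le_rfl hj.2)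
          (hlow (j - 1) j (by omega) (by omega) hj.2)
    _ = 2 * (q ^ (-(β * j)) * min M (q ^ (n / p * j) * N)) := by ring

theorem exists_eLpNorm_rieszPotential_le [IsUltrametricDist E] (hμ : IsNormalizedHaar μ q n)
    {β p : ℝ} (hβ : 0 < β) (hp : 1 < p) (hβp : p * β < n) :
    ∃ C : ℝ≥0, ∀ f, IsMeanZeroTest μ f →
      eLpNorm (rieszPotential μ q β f) (ENNReal.ofReal (n * p / (n - p * β))) μ ≤
        C * eLpNorm f (ENNReal.ofReal p) μ := by
  have hp0 : 0 < p := by linarith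
  have hn : (0 : ℝ) < n := by nlinarith
  have hd : 0 < n - p * β := sub_pos.2 hβp
  have hexp : (1 - β / (n / p)) * (n * p / (n - p * β)) = p := by
    have := hd.ne'
    field_simp
    rw [mul_comm β, div_self this]
  have hq : 0 < q := by linarith [hμ.one_lt]
  obtain ⟨C, hC, hsum⟩ := exists_sum_rpow_mul_min_le hμ.one_lt hβ
    ((lt_div_iff₀' hp0).2 hβp)
  refine ⟨(2 * C * (2 ^ p / (p - 1)) ^ (n * p / (n - p * β))⁻¹).toNNReal, fun f hf => ?_⟩
  obtain ⟨J, hJ⟩ := hf.exists_hasBand hμ.one_lt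
  have hr : Antitone fun i : ℕ => q ^ (J - i : ℤ) := fun i j hij =>
    zpow_le_zpow_right₀ hμ.one_lt.le (by omega)
  have hr0 (i : ℕ) : 0 < q ^ (J - i : ℤ) := zpow_pos hq _
  have hM0 := maximalAvg_nonneg μ (fun i : ℕ => q ^ (J - i : ℤ)) (fun y => ‖f y‖) (2 * J + 1)
  exact eLpNorm_le_of_norm_le_rpow_mul (hf.multiplier hμ.one_lt _).toIsTest hf.toIsTest
    (hf.norm.maximalAvg hr0 (2 * J + 1)) hM0 (mul_nonneg zero_le_two hC)
    (div_nonneg (by positivity) (by linarith)) hp0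
    (div_pos (mul_pos hn hp0) hd) hexp
    (integral_maximalAvg_rpow_le_integral_rpow hr hr0 hf.norm (fun x => norm_nonneg _) hp _)
    fun x => (hf.norm_rieszPotential_le hμ hJ β hp.le x).trans (by
      rw [mul_assoc]
      gcongr
      exact hsum _ _ _ (hM0 x) (by positivity))

end Haar

end Potential

/-! ### Martingales with vanishing limit -/

section Martingale

variable {E : Type*} [NormedAddCommGroup E] [IsUltrametricDist E] [ProperSpace E]
  [MeasurableSpace E] {μ : Measure E}

theorem eq_zero_of_ballAvg_succ_eq [OpensMeasurableSpace E] {r : ℕ → ℝ} (hr : ∀ l, 0 < r l)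
    (hanti : Antitone r) {S : ℕ → E → ℂ} (hS : ∀ l, IsConstOnBalls (r l) (S l))
    (havg : ∀ l, ballAvg μ (r l) (S (l + 1)) = S l) (hzero : ∀ x, ∃ l, S l x = 0) : S 0 = 0 := by
  by_contra hS0
  obtain ⟨x₀, hx₀⟩ := Function.ne_iff.1 hS0
  have hnext (l : ℕ) (x : {x // S l x ≠ 0}) :
      ∃ y : {y // S (l + 1) y ≠ 0}, dist (y : E) x ≤ r l := by
    by_contra! h
    refine x.2 ((congrFun (havg l) x).symm.trans ?_)
    rw [ballAvg_congr (g := fun _ => 0) fun y hy => by_contra fun hy0 => (h ⟨y, hy0⟩).not_ge hy]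
    simp [ballAvg]
  choose next hdist using hnext
  obtain ⟨x, hx⟩ : ∃ x : ∀ l, {x // S l x ≠ 0}, ∀ l, x (l + 1) = next l (x l) :=
    ⟨Nat.rec ⟨x₀, hx₀⟩ next, fun l => rfl⟩
  have hsucc (l : ℕ) : dist (x (l + 1) : E) (x l : E) ≤ r l := hx l ▸ hdist l (x l)
  have hnested (l : ℕ) : Metric.closedBall (x (l + 1) : E) (r (l + 1)) ⊆
      Metric.closedBall (x l : E) (r l) :=
    (Metric.closedBall_subset_closedBall (hanti l.le_succ)).trans
      (IsUltrametricDist.closedBall_eq_of_mem (hsucc l)).ge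
  obtain ⟨z, hz⟩ : (⋂ l, Metric.closedBall (x l : E) (r l)).Nonempty :=
    IsCompact.nonempty_iInter_of_sequence_nonempty_isCompact_isClosed _ hnested
      (fun l => Metric.nonempty_closedBall.2 (hr l).le) (isCompact_closedBall _ _)
      fun l => Metric.isClosed_closedBall
  obtain ⟨l, hl⟩ := hzero z
  exact (x l).2 ((hS l (Set.mem_iInter.1 hz l)).symm.trans hl)

variable [BorelSpace E] [μ.IsAddHaarMeasure] {q : ℝ}

theorem eq_zero_of_lowPass_sub_eq_zero (hq : 1 < q) {S : ℤ → E → ℂ}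
    (hconst : ∀ l, IsConstOnBalls (q ^ (-l)) fun x => S l x - S (l - 1) x)
    (havg : ∀ l x, lowPass μ q (l - 1) (fun y => S l y - S (l - 1) y) x = 0)
    (hbot : ∀ x, ∃ J, ∀ l ≤ J, S l x = 0) (htop : ∀ x, ∃ J, ∀ l, J ≤ l → S l x = 0) (l : ℤ) :
    S l = 0 := by
  have hr (l : ℤ) : 0 < q ^ (-l) := zpow_pos (zero_lt_one.trans hq) _
  have hS (l : ℤ) : IsConstOnBalls (q ^ (-l)) (S l) := fun x y hxy => by
    obtain ⟨J₁, h₁⟩ := hbot x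
    obtain ⟨J₂, h₂⟩ := hbot y
    have hsum (z : E) (hz : S (min l (min J₁ J₂)) z = 0) :
        S l z = ∑ j ∈ Finset.Ioc (min l (min J₁ J₂)) l, (S j z - S (j - 1) z) := by
      rw [sum_Ioc_sub_pred (fun j => S j z) (min_le_left _ _), hz, sub_zero]
    rw [hsum x (h₁ _ (by omega)), hsum y (h₂ _ (by omega))]
    refine Finset.sum_congr rfl fun j hj => hconst j (hxy.trans ?_)
    exact zpow_le_zpow_right₀ hq.le (by have := Finset.mem_Ioc.1 hj; omega)
  have hloc (l : ℤ) : LocallyIntegrable (S l) μ :=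
    ((hS l).isLocallyConstant (hr l)).continuous.locallyIntegrable
  have hmart (l : ℤ) : lowPass μ q l (S (l + 1)) = S l := by
    ext x
    have h := havg (l + 1) x
    rwa [add_sub_cancel_right, lowPass, ballAvg_sub (hloc _) (hloc _), (hS l).ballAvg_eq (hr l),
      sub_eq_zero] at h
  have hzero := eq_zero_of_ballAvg_succ_eq (μ := μ) (S := fun i : ℕ => S (l + i))
    (r := fun i => q ^ (-(l + i))) (fun i => hr _)
    (fun i j hij => zpow_le_zpow_right₀ hq.le (by omega)) (fun i => hS _)
    (fun i => by simpa only [Nat.cast_succ, add_assoc] using hmart (l + i))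
    fun x => let ⟨J, hJ⟩ := htop x; ⟨(J - l).toNat, hJ _ (by omega)⟩
  simpa using hzero

end Martingale

/-! ### Local fields -/

section Norms

theorem exists_norm_apply_eq {ι G : Type*} [Fintype ι] [SeminormedAddCommGroup G] {x : ι → G}
    (hx : x ≠ 0) : ∃ j, ‖x j‖ = ‖x‖ := by
  obtain ⟨i, -⟩ := Function.ne_iff.1 hx
  have : Nonempty ι := ⟨i⟩
  obtain ⟨j, hj⟩ := Finite.exists_max fun j => ‖x j‖
  exact ⟨j, (norm_le_pi_norm x j).antisymm ((pi_norm_le_iff_of_nonneg (norm_nonneg _)).2 hj)⟩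

variable {K : Type*} [NontriviallyNormedField K] [IsUltrametricDist K]

local notation "qK" => (residueCard K : ℝ)

theorem one_lt_residueCard (hK : IsNormalizedAbs K) : 1 < qK := by
  obtain ⟨β, hβ, hβnorm⟩ := hK
  obtain ⟨x, hx0, hx⟩ := NormedField.exists_norm_lt_one K
  obtain ⟨y, -, rfl⟩ : x ∈ {x | ∃ y : K, ‖y‖ ≤ 1 ∧ x = β * y} := hβ ▸ hx
  have hβ0 : 0 < ‖β‖ := norm_pos_iff.2 (left_ne_zero_of_mul (norm_pos_iff.1 hx0))
  have hβ1 : β ∈ {x : K | ‖x‖ < 1} := hβ ▸ ⟨1, by simp, by simp⟩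
  rw [hβnorm, inv_pos] at hβ0
  rwa [Set.mem_ofPred_eq, hβnorm, inv_lt_one₀ hβ0] at hβ1

theorem norm_lt_one_iff (hK : IsNormalizedAbs K) {x : K} : ‖x‖ < 1 ↔ ‖x‖ ≤ qK⁻¹ := by
  refine ⟨fun hx => ?_, fun hx => hx.trans_lt (inv_lt_one_of_one_lt₀ (one_lt_residueCard hK))⟩
  obtain ⟨β, hβ, hβnorm⟩ := hK
  obtain ⟨y, hy, rfl⟩ : x ∈ {x | ∃ y : K, ‖y‖ ≤ 1 ∧ x = β * y} := hβ ▸ hx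
  rw [norm_mul, hβnorm]
  exact mul_le_of_le_one_right (by positivity) hy

theorem exists_norm_eq_zpow (hK : IsNormalizedAbs K) (m : ℤ) : ∃ t : K, ‖t‖ = qK ^ m := by
  obtain ⟨β, -, hβnorm⟩ := hK
  exact ⟨β ^ (-m), by rw [norm_zpow, hβnorm, inv_zpow, zpow_neg, inv_inv]⟩

theorem norm_eq_zpow (hK : IsNormalizedAbs K) {x : K} (hx : x ≠ 0) : ∃ m : ℤ, ‖x‖ = qK ^ m := by
  have hq := one_lt_residueCard hK
  obtain ⟨m, hlt, hle⟩ := exists_mem_Ioc_zpow (norm_pos_iff.2 hx) hq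
  obtain ⟨t, ht⟩ := exists_norm_eq_zpow hK (m + 1)
  have hpos : 0 < qK ^ (m + 1) := by positivity
  have hquot : ‖x / t‖ = ‖x‖ / qK ^ (m + 1) := by rw [norm_div, ht]
  refine ⟨m + 1, hle.antisymm ?_⟩
  by_contra! hlt'
  rw [← div_lt_one hpos, ← hquot, norm_lt_one_iff hK, hquot, div_le_iff₀ hpos,
    zpow_add_one₀ (by positivity), mul_left_comm, inv_mul_cancel₀ (by positivity), mul_one] at hlt'
  exact hlt'.not_gt hlt

theorem pi_norm_eq_zpow (hK : IsNormalizedAbs K) {n : ℕ} {x : Fin n → K} (hx : x ≠ 0) :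
    ∃ m : ℤ, ‖x‖ = qK ^ m := by
  obtain ⟨j, hj⟩ := exists_norm_apply_eq hx
  rw [← hj]
  exact norm_eq_zpow hK (norm_ne_zero_iff.1 (hj ▸ norm_ne_zero_iff.2 hx))

open scoped NormedField Valued in
theorem residue_eq_iff {x y : 𝒪[K]} :
    IsLocalRing.residue 𝒪[K] x = IsLocalRing.residue 𝒪[K] y ↔ ‖(x - y : K)‖ < 1 := by
  rw [← sub_eq_zero, ← map_sub, IsLocalRing.residue_eq_zero_iff, IsLocalRing.mem_maximalIdeal,
    mem_nonunits_iff, Valued.integer.isUnit_iff_norm_eq_one]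
  exact (Valued.integer.norm_le_one (x - y)).lt_iff_ne.symm

open scoped NormedField Valued in
theorem exists_closedBall_zpow_eq_iUnion (hK : IsNormalizedAbs K) (m : ℤ) :
    ∃ x : 𝓀[K] → K, Metric.closedBall 0 (qK ^ (m + 1)) = ⋃ k, Metric.closedBall (x k) (qK ^ m) ∧
      Pairwise fun k l => Disjoint (Metric.closedBall (x k) (qK ^ m))
        (Metric.closedBall (x l) (qK ^ m)) := by
  have hq := one_lt_residueCard hK
  obtain ⟨t, ht⟩ := exists_norm_eq_zpow hK (m + 1)
  have ht0 : 0 < ‖t‖ := ht ▸ by positivity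
  have hmem (x y : 𝒪[K]) : t * x ∈ Metric.closedBall (t * y) (qK ^ m) ↔
      IsLocalRing.residue 𝒪[K] x = IsLocalRing.residue 𝒪[K] y := by
    rw [residue_eq_iff, norm_lt_one_iff hK, mem_closedBall_iff_norm, ← mul_sub, norm_mul,
      ← le_div_iff₀' ht0, ht, zpow_add_one₀ (by positivity), div_mul_cancel_left₀ (by positivity)]
  choose s hs using IsLocalRing.residue_surjective (R := 𝒪[K])
  refine ⟨fun k => t * s k, Set.Subset.antisymm (fun x hx => ?_) ?_, fun k l hkl => ?_⟩
  · have hx1 : ‖t⁻¹ * x‖ ≤ 1 := by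
      rw [norm_mul, norm_inv, inv_mul_le_one₀ ht0, ht]
      exact mem_closedBall_zero_iff.1 hx
    refine Set.mem_iUnion.2 ⟨IsLocalRing.residue 𝒪[K] ⟨_, Valued.integer.mem_iff.2 hx1⟩, ?_⟩
    have := (hmem ⟨_, Valued.integer.mem_iff.2 hx1⟩ _).2 (hs _).symm
    rwa [mul_inv_cancel_left₀ (norm_pos_iff.1 ht0)] at this
  · refine Set.iUnion_subset fun k => ?_
    have hk : t * s k ∈ Metric.closedBall (0 : K) (qK ^ (m + 1)) := by
      rw [mem_closedBall_zero_iff, norm_mul, ht]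
      exact mul_le_of_le_one_right (by positivity) (Valued.integer.norm_le_one (s k))
    rw [IsUltrametricDist.closedBall_eq_of_mem hk]
    exact Metric.closedBall_subset_closedBall (zpow_le_zpow_right₀ hq.le (by omega))
  · refine (IsUltrametricDist.closedBall_eq_or_disjoint _ _ _).resolve_left fun h => hkl ?_
    rw [← hs k, ← hs l, ← hmem, ← h]
    exact Metric.mem_closedBall_self (by positivity)

end Norms

section Haar

variable {K : Type*} [NontriviallyNormedField K] [LocallyCompactSpace K]

instance : ProperSpace K := .of_locallyCompactSpace K

variable [MeasurableSpace K] [BorelSpace K]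

instance : (haar K).IsAddHaarMeasure := by unfold haar; infer_instance

instance (n : ℕ) : (haarPi K n).IsAddHaarMeasure := by unfold haarPi; infer_instance

variable [IsUltrametricDist K]

local notation "qK" => (residueCard K : ℝ)

open scoped NormedField Valued in
theorem haar_real_closedBall_zpow_add_one (hK : IsNormalizedAbs K) (m : ℤ) :
    (haar K).real (Metric.closedBall 0 (qK ^ (m + 1))) =
      qK * (haar K).real (Metric.closedBall 0 (qK ^ m)) := by
  have hq := one_lt_residueCard hK
  have : Finite 𝓀[K] := Nat.finite_of_card_ne_zero fun h => by
    rw [residueCard, h] at hq; norm_num at hq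
  have := Fintype.ofFinite 𝓀[K]
  obtain ⟨x, hunion, hdisj⟩ := exists_closedBall_zpow_eq_iUnion hK m
  rw [hunion, measureReal_def,
    measure_iUnion hdisj fun k => Metric.isClosed_closedBall.measurableSet, tsum_fintype]
  simp [Measure.addHaar_closedBall_center, measureReal_def, residueCard]

theorem haar_real_closedBall_zpow (hK : IsNormalizedAbs K) (m : ℤ) :
    (haar K).real (Metric.closedBall 0 (qK ^ m)) = qK ^ m := by
  have hq : qK ≠ 0 := (zero_lt_one.trans (one_lt_residueCard hK)).ne'
  have hstep (m : ℤ) : (haar K).real (Metric.closedBall 0 (qK ^ (m + 1))) = qK ^ (m + 1) ↔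
      (haar K).real (Metric.closedBall 0 (qK ^ m)) = qK ^ m := by
    rw [haar_real_closedBall_zpow_add_one hK, zpow_add_one₀ hq, mul_comm, mul_left_inj' hq]
  induction m using Int.induction_on with
  | zero =>
    rw [zpow_zero, measureReal_def, haar, show Metric.closedBall (0 : K) 1 = unitBall K from rfl,
      Measure.addHaarMeasure_self, ENNReal.toReal_one]
  | succ i ih => exact (hstep _).2 ih
  | pred i ih => rwa [← hstep, sub_add_cancel]

theorem isNormalizedHaar_haar (hK : IsNormalizedAbs K) : IsNormalizedHaar (haar K) qK 1 where
  one_lt := one_lt_residueCard hK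
  norm_eq_zpow _ := norm_eq_zpow hK
  measureReal_closedBall m := by rw [haar_real_closedBall_zpow hK, pow_one]

theorem isNormalizedHaar_haarPi (hK : IsNormalizedAbs K) (n : ℕ) :
    IsNormalizedHaar (haarPi K n) qK n where
  one_lt := one_lt_residueCard hK
  norm_eq_zpow _ := pi_norm_eq_zpow hK
  measureReal_closedBall m := by
    rw [closedBall_pi _ (by positivity), haarPi, measureReal_def, Measure.pi_pi,
      ENNReal.toReal_prod]
    simp [← measureReal_def, haar_real_closedBall_zpow hK]

end Haar

section Characters

variable {K : Type*} [NontriviallyNormedField K] [IsUltrametricDist K] {χ : AddChar K Circle}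

local notation "qK" => (residueCard K : ℝ)

theorem exists_mul_eq_and_norm_le (hK : IsNormalizedAbs K) {x z : K} {m : ℤ} (hz : ‖z‖ = qK)
    (hx : 1 < ‖x‖ * qK ^ m) : ∃ y, ‖y‖ ≤ qK ^ m ∧ x * y = z := by
  have hq := one_lt_residueCard hK
  have hx0 : x ≠ 0 := by rintro rfl; norm_num at hx
  obtain ⟨k, hk⟩ := norm_eq_zpow hK hx0
  refine ⟨z / x, ?_, mul_div_cancel₀ z hx0⟩
  rw [hk, ← zpow_add₀ (by positivity), one_lt_zpow_iff_right₀ hq] at hx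
  rw [norm_div, hz, hk, div_le_iff₀ (by positivity), ← zpow_add₀ (by positivity)]
  exact (zpow_one _).ge.trans (zpow_le_zpow_right₀ hq.le (by omega))

theorem IsRankZero.isSelfDualPairing_mul (hK : IsNormalizedAbs K) (hχ : IsRankZero χ) :
    IsSelfDualPairing qK fun x ξ : K => χ (x * ξ) where
  symm x ξ := by rw [mul_comm]
  map_add_right x y z := by rw [mul_add, AddChar.map_add_eq_mul]
  eq_one x y h := hχ.trivial_on_integers _ (by rwa [norm_mul])
  exists_ne_one x m h := by
    obtain ⟨z, hz, hχz⟩ := hχ.nontrivial_on_sphere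
    obtain ⟨y, hy, rfl⟩ := exists_mul_eq_and_norm_le hK hz h
    exact ⟨y, hy, hχz⟩

theorem IsRankZero.isSelfDualPairing_dotProduct (hK : IsNormalizedAbs K) (hχ : IsRankZero χ)
    (n : ℕ) : IsSelfDualPairing qK fun x ξ : Fin n → K => χ (∑ j, x j * ξ j) where
  symm x ξ := by simp only [mul_comm]
  map_add_right x y z := by
    simp only [Pi.add_apply, mul_add, Finset.sum_add_distrib, AddChar.map_add_eq_mul]
  eq_one x y h := by
    refine hχ.trivial_on_integers _ (IsUltrametricDist.norm_sum_le_of_forall_le_of_nonneg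
      zero_le_one fun j _ => le_trans ?_ h)
    rw [norm_mul]
    gcongr <;> exact norm_le_pi_norm _ j
  exists_ne_one x m h := by
    have hx0 : x ≠ 0 := by rintro rfl; norm_num at h
    obtain ⟨j, hj⟩ := exists_norm_apply_eq hx0
    obtain ⟨y, hy, hne⟩ := (hχ.isSelfDualPairing_mul hK).exists_ne_one (x j) m (hj ▸ h)
    exact ⟨Pi.single j y, by rwa [Pi.norm_single], by simpa [Pi.single_apply] using hne⟩

end Characters

section Operators

variable {K : Type*} [NontriviallyNormedField K] [LocallyCompactSpace K] [MeasurableSpace K]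
  [BorelSpace K]

theorem isLizorkinLine_iff {f : K → ℂ} : IsLizorkinLine f ↔ IsMeanZeroTest (haar K) f :=
  ⟨fun h => ⟨⟨h.1, h.2⟩, h.3⟩, fun h => ⟨h.1.1, h.1.2, h.2⟩⟩

theorem isLizorkin_iff {n : ℕ} {f : (Fin n → K) → ℂ} :
    IsLizorkin f ↔ IsMeanZeroTest (haarPi K n) f :=
  ⟨fun h => ⟨⟨h.1, h.2⟩, h.3⟩, fun h => ⟨h.1.1, h.1.2, h.2⟩⟩

variable [IsUltrametricDist K] {χ : AddChar K Circle}

local notation "qK" => (residueCard K : ℝ)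

theorem fracDerivLine_eq_multiplier (hK : IsNormalizedAbs K) (hχ : IsRankZero χ) (α : ℝ)
    {f : K → ℂ} (hf : IsMeanZeroTest (haar K) f) :
    fracDerivLine χ α f = multiplier (haar K) qK (powSymbol qK α) f := by
  refine Eq.trans (funext fun x => ?_) (symbolOp_eq_multiplier (hχ.isSelfDualPairing_mul hK)
    (isNormalizedHaar_haar hK) hf fun r => ((r ^ α : ℝ) : ℂ))
  simp only [fracDerivLine, fourierLineInv, AddChar.map_neg_eq_inv]
  rfl

theorem fracDeriv_eq_multiplier (hK : IsNormalizedAbs K) (hχ : IsRankZero χ) (α : ℝ) {n : ℕ}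
    {f : (Fin n → K) → ℂ} (hf : IsMeanZeroTest (haarPi K n) f) :
    fracDeriv χ α f = multiplier (haarPi K n) qK (powSymbol qK α) f := by
  refine Eq.trans (funext fun x => ?_) (symbolOp_eq_multiplier
    (hχ.isSelfDualPairing_dotProduct hK n) (isNormalizedHaar_haarPi hK n) hf
    fun r => ((r ^ α : ℝ) : ℂ))
  simp only [fracDeriv, fourierInv, AddChar.map_neg_eq_inv]
  rfl

end Operators

/-! ### Convolution kernels -/

section Series

theorem integrable_of_hasSum {X W ι : Type*} [MeasurableSpace X] [NormedAddCommGroup W]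
    [Countable ι] {μ : Measure X} {F : ι → X → W} {g : X → W} (hF : ∀ i, Integrable (F i) μ)
    (hsum : Summable fun i => ∫ x, ‖F i x‖ ∂μ) (hg : ∀ᵐ x ∂μ, HasSum (fun i => F i x) (g x)) :
    Integrable g μ := by
  refine ⟨aestronglyMeasurable_of_tendsto_ae Filter.atTop (fun s =>
    s.aestronglyMeasurable_fun_sum fun i _ => (hF i).1) hg, ?_⟩
  calc ∫⁻ x, ‖g x‖ₑ ∂μ ≤ ∫⁻ x, ∑' i, ‖F i x‖ₑ ∂μ :=
        lintegral_mono_ae (hg.mono fun x hx => hx.tsum_eq ▸ enorm_tsum_le_tsum_enorm)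
    _ = ∑' i, ENNReal.ofReal (∫ x, ‖F i x‖ ∂μ) := by
        rw [lintegral_tsum fun i => (hF i).1.enorm]
        simp only [ofReal_integral_norm_eq_lintegral_enorm (hF _)]
    _ < ∞ := hsum.tsum_ofReal_lt_top

theorem hasSum_integral_of_hasSum {X W ι : Type*} [MeasurableSpace X] [NormedAddCommGroup W]
    [NormedSpace ℝ W] [Countable ι] {μ : Measure X} {F : ι → X → W} {g : X → W}
    (hF : ∀ i, Integrable (F i) μ) (hsum : Summable fun i => ∫ x, ‖F i x‖ ∂μ)
    (hg : ∀ᵐ x ∂μ, HasSum (fun i => F i x) (g x)) :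
    HasSum (fun i => ∫ x, F i x ∂μ) (∫ x, g x ∂μ) := by
  rw [← integral_congr_ae (hg.mono fun x hx => hx.tsum_eq)]
  exact hasSum_integral_of_summable_integral_norm hF hsum

theorem hasSum_indicator_Iic_zpow {r : ℝ} (hr : 1 < r) (m : ℤ) :
    HasSum ((Set.Iic m).indicator fun i : ℤ => (1 - r⁻¹) * r ^ i) (r ^ m) := by
  have hr0 : r ≠ 0 := by positivity
  have hinv : r⁻¹ < 1 := inv_lt_one_of_one_lt₀ hr
  have hinj : Function.Injective fun l : ℕ => m - l := fun a b h => by simpa using h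
  refine (hinj.hasSum_iff fun i hi => Set.indicator_of_notMem (fun him => hi ?_) _).1 ?_
  · rw [Set.mem_Iic] at him
    exact ⟨(m - i).toNat, by simp only; omega⟩
  · have h := (hasSum_geometric_of_lt_one (by positivity) hinv).mul_left ((1 - r⁻¹) * r ^ m)
    rw [mul_right_comm, mul_inv_cancel₀ (by linarith), one_mul] at h
    refine h.congr_fun fun l => ?_
    rw [Function.comp_apply, Set.indicator_of_mem (by simp), zpow_sub₀ hr0, zpow_natCast, inv_pow,
      mul_assoc, div_eq_mul_inv]

end Series

section Kernels

variable {E W : Type*} [NormedAddCommGroup E] [MeasurableSpace E] [NormedAddCommGroup W]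
  [NormedSpace ℝ W] {μ : Measure E} {q β : ℝ} {n : ℕ}

/-- The normalized indicator function of the ball of radius `r`, the kernel of `ballAvg μ r`. -/
noncomputable def ballKernel (μ : Measure E) (r : ℝ) : E → ℝ :=
  (Metric.closedBall 0 r).indicator fun _ => (μ.real (Metric.closedBall 0 r))⁻¹

/-- The kernel of the Riesz potential of order `β`, for `0 < β < n`. -/
noncomputable def rieszKernel (q : ℝ) (n : ℕ) (β : ℝ) (x : E) : ℝ :=
  (1 - q ^ (-β)) / (1 - q ^ (β - n)) * ‖x‖ ^ (β - n)

theorem norm_ballKernel_smul (r : ℝ) (y : E) (w : W) :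
    ‖ballKernel μ r y • w‖ = ballKernel μ r y • ‖w‖ := by
  have hnonneg : 0 ≤ ballKernel μ r y := Set.indicator_nonneg (fun _ _ => by positivity) y
  rw [norm_smul, Real.norm_of_nonneg hnonneg, smul_eq_mul]

theorem ballKernel_smul_sub (r : ℝ) (f : E → W) (x y : E) :
    ballKernel μ r y • f (x - y) = (Metric.closedBall x r).indicator
      (fun z => (μ.real (Metric.closedBall 0 r))⁻¹ • f z) (x - y) := by
  classical
  simp [ballKernel, Set.indicator_apply]

section Haar

variable [BorelSpace E] [ProperSpace E] [μ.IsAddHaarMeasure]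

theorem integral_ballKernel_smul (r : ℝ) (f : E → W) (x : E) :
    ∫ y, ballKernel μ r y • f (x - y) ∂μ = ballAvg μ r f x := by
  simp_rw [ballKernel_smul_sub]
  rw [integral_sub_left_eq_self _ μ x,
    integral_indicator Metric.isClosed_closedBall.measurableSet, integral_smul, ballAvg,
    setAverage_eq, Measure.addHaar_real_closedBall_center μ x]

theorem integrable_ballKernel_smul (r : ℝ) {f : E → W} (hf : LocallyIntegrable f μ) (x : E) :
    Integrable (fun y => ballKernel μ r y • f (x - y)) μ := by
  simp_rw [ballKernel_smul_sub]
  refine Integrable.comp_sub_left (f := (Metric.closedBall x r).indicator _)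
    ((integrable_indicator_iff Metric.isClosed_closedBall.measurableSet).2 ?_) x
  exact (hf.integrableOn_isCompact (isCompact_closedBall x r)).smul _

theorem IsTest.summable_rpow_mul_ballAvg (hμ : IsNormalizedHaar μ q n) {g : E → ℝ} (hg : IsTest g)
    (hg0 : ∀ x, 0 ≤ g x) (hβ : 0 < β) (hβn : β < n) (x : E) :
    Summable fun j : ℤ => q ^ (-(β * j)) * ballAvg μ (q ^ (-j)) g x := by
  have hq := hμ.one_lt
  obtain ⟨J, hJ, -⟩ := hg.exists_isConstOnBalls_zpow hq
  set N := ∫ y, |g y| ∂μ with hN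
  have hN0 : 0 ≤ N := integral_nonneg fun y => by positivity
  have hsmall (j : ℤ) : ballAvg μ (q ^ (-j)) g x ≤ q ^ (n * j : ℝ) * N := by
    simpa [hN] using (le_abs_self _).trans (hg.norm_ballAvg_le_rpow_mul hμ le_rfl j x)
  have hlarge (j : ℤ) : ballAvg μ (q ^ (-j)) g x ≤ max (g x) (q ^ (n * J : ℝ) * N) := by
    rcases le_total (J : ℤ) j with hj | hj
    · rw [(hJ.mono (zpow_le_zpow_right₀ hq.le (by omega))).ballAvg_eq (by positivity)]
      exact le_max_left _ _
    · refine (hsmall j).trans (le_max_of_le_right ?_)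
      gcongr
      · exact hq.le
      · exact_mod_cast hj
  obtain ⟨C, -, hsum⟩ := exists_sum_rpow_mul_min_le hq hβ hβn
  refine summable_of_sum_le (fun j => mul_nonneg (by positivity) (ballAvg_nonneg μ _ hg0 x))
    fun s => (Finset.sum_le_sum fun j _ => ?_).trans
      (hsum s (max (g x) (q ^ (n * J : ℝ) * N)) N (le_max_of_le_left (hg0 x)) hN0)
  gcongr
  exact le_min (hlarge j) (hsmall j)

end Haar

theorem zpow_mul_measureReal_closedBall (hμ : IsNormalizedHaar μ q n) (β : ℝ) (j : ℤ) :
    (q ^ (n - β)) ^ j * μ.real (Metric.closedBall 0 (q ^ (-j))) = q ^ (-(β * j)) := by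
  have hq : 0 < q := by linarith [hμ.one_lt]
  rw [hμ.measureReal_closedBall, ← Real.rpow_intCast, ← Real.rpow_mul hq.le, ← Real.rpow_intCast,
    ← Real.rpow_natCast, ← Real.rpow_mul hq.le, ← Real.rpow_add hq]
  congr 1
  push_cast
  ring

theorem hasSum_rieszKernel (hμ : IsNormalizedHaar μ q n) (hβn : β < n) {x : E} (hx : x ≠ 0) :
    HasSum (fun j : ℤ => (1 - q ^ (-β)) * q ^ (-(β * j)) * ballKernel μ (q ^ (-j)) x)
      (rieszKernel q n β x) := by
  have hq := hμ.one_lt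
  have hq0 : 0 < q := by positivity
  have hr : 1 < q ^ (n - β) := Real.one_lt_rpow hq (by linarith)
  obtain ⟨m, hm⟩ := hμ.norm_eq_zpow x hx
  have hinv : (q ^ (n - β))⁻¹ = q ^ (β - n) := by rw [← Real.rpow_neg hq0.le, neg_sub]
  have hpow : (q ^ (n - β)) ^ (-m) = ‖x‖ ^ (β - n) := by
    rw [hm, zpow_neg, ← inv_zpow, hinv, ← Real.rpow_intCast, ← Real.rpow_intCast,
      ← Real.rpow_mul hq0.le, ← Real.rpow_mul hq0.le, mul_comm]
  have hne : 1 - q ^ (β - n) ≠ 0 := by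
    rw [← hinv]
    linarith [inv_lt_one_of_one_lt₀ hr]
  have hsum := (hasSum_indicator_Iic_zpow hr (-m)).mul_left ((1 - q ^ (-β)) / (1 - q ^ (β - n)))
  rw [hpow] at hsum
  classical
  refine hsum.congr_fun fun j => ?_
  simp only [Set.indicator_apply, ballKernel, mem_closedBall_zero_iff, hm,
    zpow_le_zpow_iff_right₀ hq, Set.mem_Iic, le_neg]
  split_ifs
  · rw [← zpow_mul_measureReal_closedBall hμ, hinv]
    have := (hμ.measureReal_closedBall (-j)).trans_ne (by positivity)
    field_simp
  · simp

theorem IsNormalizedHaar.measure_singleton_zero [IsFiniteMeasureOnCompacts μ] [ProperSpace E]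
    (hμ : IsNormalizedHaar μ q n) (hn : n ≠ 0) : μ {0} = 0 := by
  have hq := hμ.one_lt
  have hlim : Filter.Tendsto (fun m : ℕ => ((q⁻¹) ^ m) ^ n) Filter.atTop (nhds 0) := by
    simpa [hn] using (tendsto_pow_atTop_nhds_zero_of_lt_one (by positivity)
      (inv_lt_one_of_one_lt₀ hq)).pow n
  refine (measureReal_eq_zero_iff isCompact_singleton.measure_ne_top).1
    ((ge_of_tendsto' hlim fun m => ?_).antisymm measureReal_nonneg)
  have hle := measureReal_mono (μ := μ) (Set.singleton_subset_iff.2 (Metric.mem_closedBall_self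
    (x := (0 : E)) (zpow_nonneg (zero_le_one.trans hq.le) (-(m : ℤ))))) measure_closedBall_lt_top.ne
  rwa [hμ.measureReal_closedBall, zpow_neg, zpow_natCast, ← inv_pow] at hle

theorem IsNormalizedHaar.norm_le_of_lt (hμ : IsNormalizedHaar μ q n) {x : E} {k : ℤ}
    (h : ‖x‖ < q ^ (-k)) : ‖x‖ ≤ q ^ (-(k + 1)) := by
  have hq := hμ.one_lt
  rcases eq_or_ne x 0 with rfl | hx
  · rw [norm_zero]
    positivity
  · obtain ⟨m, hm⟩ := hμ.norm_eq_zpow x hx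
    rw [hm] at h ⊢
    exact zpow_le_zpow_right₀ hq.le (by have := (zpow_lt_zpow_iff_right₀ hq).1 h; omega)

theorem hasSum_ite_rpow (hq : 1 < q) (hβ : 0 < β) (i : ℤ) :
    HasSum (fun j : ℤ => if i ≤ j then (1 - q ^ (-β)) * q ^ (-(β * j)) else 0)
      (q ^ (-(β * i))) := by
  have hq0 : 0 ≤ q := by linarith
  have hpow (j : ℤ) : (q ^ β) ^ (-j) = q ^ (-(β * j)) := by
    rw [← Real.rpow_intCast, ← Real.rpow_mul hq0, Int.cast_neg, mul_neg]
  have h := (Equiv.neg ℤ).hasSum_iff.2 (hasSum_indicator_Iic_zpow (Real.one_lt_rpow hq hβ) (-i))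
  classical
  simpa only [Function.comp_def, Set.indicator_apply, Equiv.neg_apply, Set.mem_Iic, neg_le_neg_iff,
    hpow, ← Real.rpow_neg hq0] using h

section Convolution

variable [BorelSpace E] [ProperSpace E] [μ.IsAddHaarMeasure] {f : E → ℂ}

theorem hasSum_integral_rieszKernel_smul (hμ : IsNormalizedHaar μ q n) (hβ : 0 < β) (hβn : β < n)
    (hf : IsTest f) (x : E) : Integrable (fun y => rieszKernel q n β y • f (x - y)) μ ∧
      HasSum (fun j : ℤ => ((1 - q ^ (-β)) * q ^ (-(β * j))) • lowPass μ q j f x)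
        (∫ y, rieszKernel q n β y • f (x - y) ∂μ) := by
  have hq := hμ.one_lt
  have hc : 0 ≤ 1 - q ^ (-β) := by
    linarith [Real.rpow_le_one_of_one_le_of_nonpos hq.le (neg_nonpos.2 hβ.le)]
  have hc (j : ℤ) : 0 ≤ (1 - q ^ (-β)) * q ^ (-(β * j)) := mul_nonneg hc (by positivity)
  have hn : n ≠ 0 := by
    rintro rfl
    norm_num at hβn
    linarith
  set F : ℤ → E → ℂ := fun j y =>
    ((1 - q ^ (-β)) * q ^ (-(β * j))) • ballKernel μ (q ^ (-j)) y • f (x - y) with hF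
  have hint (j : ℤ) : Integrable (F j) μ :=
    (integrable_ballKernel_smul (q ^ (-j)) (hf.integrable (μ := μ)).locallyIntegrable x).smul
      ((1 - q ^ (-β)) * q ^ (-(β * j)))
  have hnorm : Summable fun j => ∫ y, ‖F j y‖ ∂μ := by
    refine ((hf.norm.summable_rpow_mul_ballAvg hμ (fun _ => norm_nonneg _) hβ hβn x).mul_left
      (1 - q ^ (-β))).congr fun j => ?_
    simp only [hF, norm_smul _ (_ • _), norm_ballKernel_smul, Real.norm_of_nonneg (hc j),
      integral_const_mul]
    rw [integral_ballKernel_smul _ (fun y => ‖f y‖), mul_assoc]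
  have hsum : ∀ᵐ y ∂μ, HasSum (fun j => F j y) (rieszKernel q n β y • f (x - y)) := by
    have hne : ∀ᵐ y ∂μ, y ≠ 0 := compl_mem_ae_iff.2 (hμ.measure_singleton_zero hn)
    filter_upwards [hne] with y hy
    simpa only [hF, smul_smul] using (hasSum_rieszKernel hμ hβn hy).smul_const (f (x - y))
  refine ⟨integrable_of_hasSum hint hnorm hsum, ?_⟩
  simpa only [hF, integral_smul, integral_ballKernel_smul] using
    hasSum_integral_of_hasSum hint hnorm hsum

theorem integral_rieszKernel_smul [IsUltrametricDist E] (hμ : IsNormalizedHaar μ q n) (hβ : 0 < β)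
    (hβn : β < n) (hf : IsMeanZeroTest μ f) (x : E) :
    ∫ y, rieszKernel q n β y • f (x - y) ∂μ = rieszPotential μ q β f x := by
  obtain ⟨J, hJ⟩ := hf.exists_hasBand hμ.one_lt
  have hlow (j : ℤ) : ((1 - q ^ (-β)) * q ^ (-(β * j))) • lowPass μ q j f x =
      ∑ i ∈ Finset.Ioc (-(J : ℤ)) J,
        (if i ≤ j then (1 - q ^ (-β)) * q ^ (-(β * j)) else 0) • bandPass μ q i f x := by
    rw [hf.lowPass_eq_multiplier hμ.one_lt, hJ.multiplier_eq_sum, Finset.smul_sum]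
    refine Finset.sum_congr rfl fun i _ => ?_
    split_ifs <;> simp
  refine (hasSum_integral_rieszKernel_smul hμ hβ hβn hf.toIsTest x).2.unique ?_
  simp_rw [hlow]
  rw [rieszPotential, hJ.multiplier_eq_sum]
  refine hasSum_sum fun i _ => ?_
  convert (hasSum_ite_rpow hμ.one_lt hβ i).smul_const (bandPass μ q i f x) using 1
  rw [powSymbol, Complex.real_smul, ← Real.rpow_intCast, ← Real.rpow_mul (by linarith [hμ.one_lt])]
  congr 3
  ring

end Convolution

end Kernels

section LocalField

variable {K : Type*} [NontriviallyNormedField K] {n : ℕ}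

section Real

variable [LocallyCompactSpace K] [MeasurableSpace K] [BorelSpace K]

theorem conv_ofReal (k : (Fin n → K) → ℝ) (f : (Fin n → K) → ℂ) (x : Fin n → K) :
    conv (fun y => (k y : ℂ)) f x = ∫ y, k y • f (x - y) ∂(haarPi K n) := by
  simp only [conv, convolution_def, ContinuousLinearMap.mul_apply', Complex.real_smul]

theorem convExists_ofReal {k : (Fin n → K) → ℝ} {f : (Fin n → K) → ℂ}
    (h : ∀ x, Integrable (fun y => k y • f (x - y)) (haarPi K n)) :
    ConvExists (fun y => (k y : ℂ)) f := fun x => by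
  simpa only [ConvolutionExistsAt, ContinuousLinearMap.mul_apply', Complex.real_smul] using h x

end Real

variable [IsUltrametricDist K]

local notation "qK" => (residueCard K : ℝ)

theorem kernelA_eq_rieszKernel (x : Fin n → K) :
    kernelA x = (rieszKernel qK n (n - 1) x : ℂ) := by
  rw [kernelA, rieszKernel, neg_sub, sub_sub_cancel_left, Real.rpow_neg_one, Real.rpow_neg_one,
    ← Real.rpow_intCast]
  push_cast
  ring_nf

variable [LocallyCompactSpace K] [MeasurableSpace K] [BorelSpace K]

theorem convExists_kernelA (hK : IsNormalizedAbs K) (hn : 2 ≤ n) {f : (Fin n → K) → ℂ}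
    (hf : IsTest f) : ConvExists kernelA f := by
  have hβ : (1 : ℝ) < n := Nat.one_lt_cast.2 hn
  simp only [funext kernelA_eq_rieszKernel]
  exact convExists_ofReal fun x => (hasSum_integral_rieszKernel_smul
    (isNormalizedHaar_haarPi hK n) (sub_pos.2 hβ) (by linarith) hf x).1

theorem conv_kernelA (hK : IsNormalizedAbs K) (hn : 2 ≤ n) {f : (Fin n → K) → ℂ}
    (hf : IsMeanZeroTest (haarPi K n) f) :
    conv kernelA f = rieszPotential (haarPi K n) qK (n - 1) f := by
  have hβ : (1 : ℝ) < n := Nat.one_lt_cast.2 hn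
  funext x
  rw [funext kernelA_eq_rieszKernel, conv_ofReal, integral_rieszKernel_smul
    (isNormalizedHaar_haarPi hK n) (sub_pos.2 hβ) (by linarith) hf]

theorem kernelB_eq_ballKernel (hK : IsNormalizedAbs K) {t : K} {k : ℤ} (ht : ‖t‖ = qK ^ (-k))
    (y : Fin n → K) :
    kernelB t y = ((qK / (qK - 1) * ballKernel (haarPi K n) (qK ^ (-k)) y -
      (qK - 1)⁻¹ * ballKernel (haarPi K n) (qK ^ (-(k + 1))) y : ℝ) : ℂ) := by
  have hμ := isNormalizedHaar_haarPi hK n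
  have hq := hμ.one_lt
  have hr : 0 < qK ^ (-k) := by positivity
  have hsucc : qK ^ (-(k + 1)) = qK ^ (-k) * qK⁻¹ := by
    rw [neg_add, zpow_add₀ (by positivity), zpow_neg_one]
  have hlt : qK ^ (-(k + 1)) < qK ^ (-k) := zpow_lt_zpow_right₀ hq (by omega)
  have hnorm : ‖t⁻¹ • y‖ = ‖y‖ / qK ^ (-k) := by rw [norm_smul, norm_inv, ht, inv_mul_eq_div]
  have hq1 : (residueCard K : ℂ) - 1 ≠ 0 := by exact_mod_cast (sub_pos.2 hq).ne'
  classical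
  simp only [kernelB, bTilde, hnorm, ht, ballKernel, Set.indicator_apply, mem_closedBall_zero_iff,
    hμ.measureReal_closedBall, div_le_iff₀' hr, ← hsucc, div_eq_one_iff_eq hr.ne']
  rcases lt_trichotomy ‖y‖ (qK ^ (-k)) with h | h | h
  · rw [if_pos (hμ.norm_le_of_lt h), if_pos (hμ.norm_le_of_lt h), if_pos h.le, hsucc,
      mul_pow, inv_pow]
    push_cast
    field_simp
  · rw [if_neg (by linarith), if_pos h, if_pos h.le, if_neg (by linarith)]
    push_cast
    ring
  · rw [if_neg (by linarith), if_neg h.ne', if_neg (by linarith), if_neg (by linarith)]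
    simp

theorem convExists_kernelB (hK : IsNormalizedAbs K) {t : K} (ht : t ≠ 0) {f : (Fin n → K) → ℂ}
    (hf : IsTest f) : ConvExists (kernelB t) f := by
  obtain ⟨k, hk⟩ := norm_eq_zpow hK ht
  rw [← neg_neg k] at hk
  have hint (r c : ℝ) (x : Fin n → K) := (integrable_ballKernel_smul r
    (hf.integrable (μ := haarPi K n)).locallyIntegrable x).smul c
  simp only [funext (kernelB_eq_ballKernel hK hk)]
  refine convExists_ofReal fun x => ?_
  simp only [sub_smul, mul_smul]
  exact (hint _ _ x).sub (hint _ _ x)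

theorem conv_kernelB (hK : IsNormalizedAbs K) {t : K} {k : ℤ} (ht : ‖t‖ = qK ^ (-k))
    {f : (Fin n → K) → ℂ} (hf : IsTest f) (x : Fin n → K) :
    conv (kernelB t) f x = qK / (qK - 1) * lowPass (haarPi K n) qK k f x -
      (qK - 1 : ℂ)⁻¹ * lowPass (haarPi K n) qK (k + 1) f x := by
  have hint (r c : ℝ) : Integrable (fun y => c • ballKernel (haarPi K n) r y • f (x - y))
      (haarPi K n) :=
    (integrable_ballKernel_smul r (hf.integrable (μ := haarPi K n)).locallyIntegrable x).smul c
  rw [funext (kernelB_eq_ballKernel hK ht), conv_ofReal]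
  simp only [sub_smul, mul_smul]
  rw [integral_sub (hint _ _) (hint _ _), integral_smul, integral_smul, integral_ballKernel_smul,
    integral_ballKernel_smul, Complex.real_smul, Complex.real_smul]
  push_cast
  rfl

end LocalField

/-! ### The wave equation -/

section Radial

variable {E : Type*} [NormedAddCommGroup E] [MeasurableSpace E] {μ : Measure E} {q : ℝ} {n : ℕ}

theorem IsNormalizedHaar.exists_norm_eq (hμ : IsNormalizedHaar μ q n) (hn : n ≠ 0) (k : ℤ) :
    ∃ x : E, ‖x‖ = q ^ (-k) := by
  have hq := hμ.one_lt
  by_contra! hne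
  have hball : Metric.closedBall (0 : E) (q ^ (-k)) = Metric.closedBall 0 (q ^ (-(k + 1))) := by
    refine Set.Subset.antisymm (fun x hx => ?_)
      (Metric.closedBall_subset_closedBall (zpow_le_zpow_right₀ hq.le (by omega)))
    rw [mem_closedBall_zero_iff] at hx ⊢
    exact hμ.norm_le_of_lt (hx.lt_of_ne (hne x))
  have hmeas := congrArg μ.real hball
  rw [hμ.measureReal_closedBall, hμ.measureReal_closedBall,
    pow_left_inj₀ (by positivity) (by positivity) hn] at hmeas
  have := zpow_right_injective₀ (by positivity) hq.ne' hmeas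
  omega

theorem ballAvg_of_radial [IsUltrametricDist E] [OpensMeasurableSpace E] [ProperSpace E]
    [IsFiniteMeasureOnCompacts μ] [μ.IsOpenPosMeasure] {u : E → ℂ} {r : ℝ} (hr : 0 < r)
    (hradial : ∀ x y, ‖x‖ = ‖y‖ → u x = u y) (x : E) :
    ballAvg μ r u x = if ‖x‖ ≤ r then ballAvg μ r u 0 else u x := by
  split_ifs with h
  · exact isConstOnBalls_ballAvg μ r u (by rwa [dist_zero_right])
  · rw [ballAvg_congr (g := fun _ => u x) fun y hy => hradial y x ?_, ballAvg_const hr]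
    rw [← norm_neg x]
    refine IsUltrametricDist.norm_eq_of_add_norm_lt_max ?_
    rw [← sub_eq_add_neg, ← dist_eq_norm, norm_neg]
    exact hy.trans_lt ((not_le.1 h).trans_le (le_max_right _ _))

theorem mul_eq_lowPass_of_radial [BorelSpace E] [ProperSpace E] [μ.IsAddHaarMeasure]
    (hμ : IsNormalizedHaar μ q n) {u : E → ℂ} (hu : LocallyIntegrable u μ)
    (hradial : ∀ x y, ‖x‖ = ‖y‖ → u x = u y) {k : ℤ} {x : E} (hx : ‖x‖ = q ^ (-k)) :
    ((q : ℂ) ^ n - 1) * u x = (q : ℂ) ^ n * lowPass μ q k u 0 - lowPass μ q (k + 1) u 0 := by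
  have hq := hμ.one_lt
  have hball : ∫ y in Metric.closedBall 0 (q ^ (-k)), (u y - u x) ∂μ =
      ∫ y in Metric.closedBall 0 (q ^ (-(k + 1))), (u y - u x) ∂μ := by
    refine (setIntegral_eq_of_subset_of_forall_sdiff_eq_zero
      Metric.isClosed_closedBall.measurableSet
      (Metric.closedBall_subset_closedBall (zpow_le_zpow_right₀ hq.le (by omega))) fun y hy => ?_)
    rw [Set.mem_sdiff, mem_closedBall_zero_iff, mem_closedBall_zero_iff] at hy
    rw [hradial y x (le_antisymm (hx ▸ hy.1) (not_lt.1 fun h => hy.2 (hμ.norm_le_of_lt (hx ▸ h)))),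
      sub_self]
  have havg (j : ℤ) : ∫ y in Metric.closedBall 0 (q ^ (-j)), (u y - u x) ∂μ =
      (((q ^ (-j)) ^ n : ℝ) : ℂ) * (lowPass μ q j u 0 - u x) := by
    rw [← measure_smul_setAverage _ measure_closedBall_lt_top.ne, ← ballAvg, ballAvg_sub hu
      (locallyIntegrable_const _), ballAvg_const (by positivity), hμ.measureReal_closedBall,
      Complex.real_smul]
  rw [havg, havg, neg_add, zpow_add₀ (by positivity), zpow_neg_one, mul_pow, Complex.ofReal_mul,
    mul_assoc, mul_right_inj' (by exact_mod_cast (by positivity : 0 < (q ^ (-k)) ^ n).ne')] at hball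
  have hqn : (q : ℂ) ^ n ≠ 0 := by exact_mod_cast (by positivity : 0 < q ^ n).ne'
  push_cast at hball
  rw [inv_pow, eq_inv_mul_iff_mul_eq₀ hqn] at hball
  linear_combination -hball

end Radial

section Profile

/-- The value on the sphere `‖t‖ = ρ` of the radial function of `t` in a one-dimensional space which
equals `1` at the origin and all of whose frequencies have norm `q ^ j`. It plays the role of
`cos (j t)` for the classical wave equation. -/
noncomputable def waveProfile (q : ℝ) (j : ℤ) (ρ : ℝ) : ℂ :=
  q / (q - 1) * (if ρ ≤ q ^ (-j) then 1 else 0) -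
    (q - 1 : ℂ)⁻¹ * if ρ ≤ q ^ (-(j - 1)) then 1 else 0

variable {q : ℝ}

theorem waveProfile_zero (hq : 1 < q) (j : ℤ) : waveProfile q j 0 = 1 := by
  have hq1 : (q : ℂ) - 1 ≠ 0 := by exact_mod_cast (sub_pos.2 hq).ne'
  rw [waveProfile, if_pos (by positivity), if_pos (by positivity)]
  field_simp

theorem waveProfile_zpow (hq : 1 < q) (j k : ℤ) :
    waveProfile q j (q ^ (-k)) =
      q / (q - 1) * (if j ≤ k then 1 else 0) - (q - 1 : ℂ)⁻¹ * if j ≤ k + 1 then 1 else 0 := by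
  simp only [waveProfile, zpow_le_zpow_iff_right₀ hq, neg_le_neg_iff, sub_le_iff_le_add]

variable {T : Type*} [NormedAddCommGroup T] [IsUltrametricDist T]

theorem isConstOnBalls_waveProfile (hq : 1 < q) (j : ℤ) :
    IsConstOnBalls (q ^ (-j)) fun t : T => waveProfile q j ‖t‖ := fun s t h => by
  have hle : q ^ (-j) ≤ q ^ (-(j - 1)) := zpow_le_zpow_right₀ hq.le (by omega)
  have hiff (r : ℝ) (hr : q ^ (-j) ≤ r) : ‖s‖ ≤ r ↔ ‖t‖ ≤ r := by
    simpa only [mem_closedBall_zero_iff] using mem_closedBall_iff_of_dist_le (x := 0) (h.trans hr)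
  simp only [waveProfile, hiff _ le_rfl, hiff _ hle]

theorem norm_le_of_waveProfile_ne_zero (hq : 1 < q) {j : ℤ} {ρ : ℝ} (h : waveProfile q j ρ ≠ 0) :
    ρ ≤ q ^ (-(j - 1)) := by
  contrapose! h
  have hle : q ^ (-j) ≤ q ^ (-(j - 1)) := zpow_le_zpow_right₀ hq.le (by omega)
  rw [waveProfile, if_neg (hle.trans_lt h).not_ge, if_neg h.not_ge, mul_zero, mul_zero, sub_zero]

variable [MeasurableSpace T] [BorelSpace T] [ProperSpace T] {ν : Measure T} [ν.IsAddHaarMeasure]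

theorem isMeanZeroTest_waveProfile (hν : IsNormalizedHaar ν q 1) (j : ℤ) :
    IsMeanZeroTest ν fun t => waveProfile q j ‖t‖ where
  toIsTest := (isConstOnBalls_waveProfile hν.one_lt j).isTest (by have := hν.one_lt; positivity)
    fun t => norm_le_of_waveProfile_ne_zero hν.one_lt
  integral_eq_zero := by
    have hq := hν.one_lt
    have hq1 : (q : ℂ) - 1 ≠ 0 := by exact_mod_cast (sub_pos.2 hq).ne'
    have hball (i : ℤ) (t : T) : (if ‖t‖ ≤ q ^ (-i) then (1 : ℂ) else 0) =
        (Metric.closedBall 0 (q ^ (-i))).indicator (fun _ => 1) t := by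
      classical
      simp only [Set.indicator_apply, mem_closedBall_zero_iff]
    have hint (i : ℤ) (c : ℂ) : Integrable
        (fun t : T => c * (Metric.closedBall 0 (q ^ (-i))).indicator (fun _ => (1 : ℂ)) t) ν :=
      ((integrable_indicator_iff Metric.isClosed_closedBall.measurableSet).2
        (integrableOn_const measure_closedBall_lt_top.ne)).const_mul c
    simp only [waveProfile, hball]
    rw [integral_sub (hint _ _) (hint _ _), integral_const_mul, integral_const_mul,
      integral_indicator_const _ Metric.isClosed_closedBall.measurableSet,
      integral_indicator_const _ Metric.isClosed_closedBall.measurableSet,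
      hν.measureReal_closedBall, hν.measureReal_closedBall, neg_sub, zpow_sub₀ (by positivity),
      zpow_neg]
    simp only [Complex.real_smul]
    push_cast
    field_simp
    ring

theorem bandPass_waveProfile (hν : IsNormalizedHaar ν q 1) (i j : ℤ) :
    bandPass ν q i (fun t => waveProfile q j ‖t‖) =
      if i = j then fun t => waveProfile q j ‖t‖ else 0 := by
  have hq := hν.one_lt
  have hw := isMeanZeroTest_waveProfile hν j
  have hlow (l : ℤ) : lowPass ν q l (fun t => waveProfile q j ‖t‖) =
      if j ≤ l then fun t => waveProfile q j ‖t‖ else 0 := by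
    split_ifs with h
    · exact ((isConstOnBalls_waveProfile hq j).mono
        (zpow_le_zpow_right₀ hq.le (by omega))).ballAvg_eq (by positivity)
    · exact funext fun t => ballAvg_eq_zero_of_integral_eq_zero (fun s hs =>
        (norm_le_of_waveProfile_ne_zero hq hs).trans (zpow_le_zpow_right₀ hq.le (by omega)))
        hw.integral_eq_zero t
  funext t
  simp only [bandPass, hlow]
  split_ifs <;> first | omega | simp

theorem multiplier_waveProfile (hν : IsNormalizedHaar ν q 1) (a : ℤ → ℂ) (j : ℤ) :
    multiplier ν q a (fun t : T => waveProfile q j ‖t‖) = fun t => a j * waveProfile q j ‖t‖ := by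
  refine (IsMeanZeroTest.eq_multiplier hν.one_lt (isMeanZeroTest_waveProfile hν j)
    ((isMeanZeroTest_waveProfile hν j).const_mul (a j)) fun i t => ?_).symm
  rw [bandPass_const_mul, bandPass_waveProfile hν]
  split_ifs with h
  · rw [h]
  · simp

theorem bandPass_eq_waveProfile_mul (hν : IsNormalizedHaar ν q 1) {u : T → ℂ}
    (hu : LocallyIntegrable u ν) (hradial : ∀ s t, ‖s‖ = ‖t‖ → u s = u t) (j : ℤ) (t : T) :
    bandPass ν q j u t = waveProfile q j ‖t‖ * bandPass ν q j u 0 := by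
  have hq := hν.one_lt
  have hq1 : (q : ℂ) - 1 ≠ 0 := by exact_mod_cast (sub_pos.2 hq).ne'
  have hlow (i : ℤ) := ballAvg_of_radial (μ := ν) (r := q ^ (-i)) (by positivity) hradial t
  have hlt : q ^ (-j) < q ^ (-(j - 1)) := zpow_lt_zpow_right₀ hq (by omega)
  simp only [bandPass, hlow, waveProfile]
  rcases lt_trichotomy ‖t‖ (q ^ (-(j - 1))) with h | h | h
  · have hle : ‖t‖ ≤ q ^ (-j) := by simpa using hν.norm_le_of_lt h
    rw [if_pos hle, if_pos h.le, if_pos hle, if_pos h.le]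
    field_simp
  · have hsphere := mul_eq_lowPass_of_radial hν hu hradial h
    rw [sub_add_cancel, pow_one] at hsphere
    rw [if_neg (h ▸ hlt).not_ge, if_pos h.le, if_neg (h ▸ hlt).not_ge, if_pos h.le]
    field_simp
    linear_combination hsphere
  · rw [if_neg (hlt.trans h).not_ge, if_neg h.not_ge, if_neg (hlt.trans h).not_ge, if_neg h.not_ge]
    ring

end Profile

section Existence

variable {E : Type*} [NormedAddCommGroup E] [MeasurableSpace E] {μ : Measure E} {q : ℝ} {ψ : E → ℂ}

/-- The solution, at times of norm `ρ`, of the wave equation with initial value `ψ`. -/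
noncomputable def wave (μ : Measure E) (q ρ : ℝ) (ψ : E → ℂ) : E → ℂ :=
  multiplier μ q (fun j => waveProfile q j ρ) ψ

theorem HasBand.wave_apply {J : ℕ} (hψ : HasBand μ q J ψ) (ρ : ℝ) (x : E) :
    wave μ q ρ ψ x =
      ∑ j ∈ Finset.Ioc (-(J : ℤ)) J, bandPass μ q j ψ x * waveProfile q j ρ := by
  simp only [wave, hψ.multiplier_eq_sum, mul_comm]

variable [IsUltrametricDist E] [ProperSpace E] [BorelSpace E] [μ.IsAddHaarMeasure]

theorem IsMeanZeroTest.wave (hq : 1 < q) (hψ : IsMeanZeroTest μ ψ) (ρ : ℝ) :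
    IsMeanZeroTest μ (wave μ q ρ ψ) :=
  hψ.multiplier hq _

theorem wave_zero (hq : 1 < q) (hψ : IsMeanZeroTest μ ψ) : wave μ q 0 ψ = ψ := by
  simp only [wave, waveProfile_zero hq, hψ.multiplier_one hq]

theorem wave_zpow (hq : 1 < q) (hψ : IsMeanZeroTest μ ψ) (k : ℤ) :
    wave μ q (q ^ (-k)) ψ = fun x =>
      q / (q - 1) * lowPass μ q k ψ x - (q - 1 : ℂ)⁻¹ * lowPass μ q (k + 1) ψ x := by
  have hlow (c : ℂ) (m : ℤ) : IsMeanZeroTest μ fun x => c * lowPass μ q m ψ x :=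
    (hψ.lowPass hq m).const_mul c
  refine (IsMeanZeroTest.eq_multiplier hq hψ ((hlow _ _).sub (hlow _ _)) fun j x => ?_).symm
  rw [bandPass_sub (hlow _ _).locallyIntegrable (hlow _ _).locallyIntegrable, bandPass_const_mul,
    bandPass_const_mul, bandPass_lowPass hq hψ.locallyIntegrable,
    bandPass_lowPass hq hψ.locallyIntegrable, waveProfile_zpow hq]
  split_ifs <;> simp [sub_mul]

theorem wave_multiplier (hq : 1 < q) (hψ : IsMeanZeroTest μ ψ) (ρ : ℝ) (a : ℤ → ℂ) :
    wave μ q ρ (multiplier μ q a ψ) = multiplier μ q a (wave μ q ρ ψ) := by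
  simp only [wave, hψ.multiplier_multiplier hq, mul_comm]

theorem eLpNorm_wave_le {T : Type*} [NormedAddCommGroup T] [MeasurableSpace T] {ν : Measure T}
    (hν : IsNormalizedHaar ν q 1) (hψ : IsMeanZeroTest μ ψ) {p : ℝ} (hp : 1 ≤ p) (t : T) :
    eLpNorm (wave μ q ‖t‖ ψ) (ENNReal.ofReal p) μ ≤
      (q / (q - 1) + (q - 1)⁻¹).toNNReal * eLpNorm ψ (ENNReal.ofReal p) μ := by
  have hq := hν.one_lt
  have hq1 : 0 < q - 1 := sub_pos.2 hq
  rcases eq_or_ne t 0 with rfl | ht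
  · rw [norm_zero, wave_zero hq hψ]
    refine le_mul_of_one_le_left zero_le ?_
    rw [ENNReal.one_le_coe_iff, Real.one_le_toNNReal]
    exact le_add_of_le_of_nonneg ((one_le_div hq1).2 (sub_le_self _ zero_le_one)) (by positivity)
  obtain ⟨k, hk⟩ := hν.norm_eq_zpow t ht
  have hwave : wave μ q ‖t‖ ψ =
      (q / (q - 1)) • lowPass μ q (-k) ψ - (q - 1)⁻¹ • lowPass μ q (-k + 1) ψ := by
    rw [hk, ← neg_neg k, wave_zpow hq hψ, neg_neg]
    funext x
    simp only [Pi.sub_apply, Pi.smul_apply, Complex.real_smul]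
    push_cast
    rfl
  have hmeas (c : ℝ) (m : ℤ) : AEStronglyMeasurable (c • lowPass μ q m ψ) μ :=
    ((hψ.lowPass hq m).continuous.const_smul c).aestronglyMeasurable
  have hle {c : ℝ} (hc : 0 ≤ c) (m : ℤ) : eLpNorm (c • lowPass μ q m ψ) (ENNReal.ofReal p) μ ≤
      ENNReal.ofReal c * eLpNorm ψ (ENNReal.ofReal p) μ := by
    rw [eLpNorm_const_smul, Real.enorm_of_nonneg hc]
    gcongr
    exact hψ.toIsTest.eLpNorm_ballAvg_le (by positivity) hp
  rw [hwave]
  refine (eLpNorm_sub_le (hmeas _ _) (hmeas _ _) (ENNReal.one_le_ofReal.2 hp)).trans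
    ((add_le_add (hle (by positivity) _) (hle (by positivity) _)).trans_eq ?_)
  rw [← add_mul, ← ENNReal.ofReal_add (by positivity) (by positivity)]
  rfl

theorem exists_eLpNorm_wave_rieszPotential_le {T : Type*} [NormedAddCommGroup T]
    [MeasurableSpace T] {ν : Measure T} (hν : IsNormalizedHaar ν q 1) {n : ℕ}
    (hμ : IsNormalizedHaar μ q n) {β p : ℝ} (hβ : 0 < β) (hp : 1 < p) (hβp : p * β < n) :
    ∃ C : ℝ≥0, ∀ ψ, IsMeanZeroTest μ ψ → ∀ t : T,
      eLpNorm (wave μ q ‖t‖ (rieszPotential μ q β ψ)) (ENNReal.ofReal (n * p / (n - p * β))) μ ≤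
        C * eLpNorm ψ (ENNReal.ofReal p) μ := by
  obtain ⟨C, hC⟩ := exists_eLpNorm_rieszPotential_le hμ hβ hp hβp
  refine ⟨(q / (q - 1) + (q - 1)⁻¹).toNNReal * C, fun ψ hψ t => ?_⟩
  have hexp : 1 ≤ n * p / (n - p * β) := by
    rw [one_le_div (sub_pos.2 hβp)]
    nlinarith [mul_pos (zero_lt_one.trans hp) hβ]
  rw [ENNReal.coe_mul, mul_assoc]
  exact (eLpNorm_wave_le hν (hψ.multiplier hμ.one_lt _) hexp t).trans (by gcongr; exact hC ψ hψ)

variable {T : Type*} [NormedAddCommGroup T] [IsUltrametricDist T] [ProperSpace T]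
  [MeasurableSpace T] [BorelSpace T] {ν : Measure T} [ν.IsAddHaarMeasure]

theorem isMeanZeroTest_wave_time (hν : IsNormalizedHaar ν q 1) (hψ : IsMeanZeroTest μ ψ) (x : E) :
    IsMeanZeroTest ν fun t => wave μ q ‖t‖ ψ x := by
  obtain ⟨J, hJ⟩ := hψ.exists_hasBand hν.one_lt
  simp only [hJ.wave_apply]
  exact IsMeanZeroTest.sum_mul _ _ fun j _ => isMeanZeroTest_waveProfile hν j

theorem multiplier_wave_time (hν : IsNormalizedHaar ν q 1) (hψ : IsMeanZeroTest μ ψ) (a : ℤ → ℂ)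
    (t : T) (x : E) :
    multiplier ν q a (fun s => wave μ q ‖s‖ ψ x) t = multiplier μ q a (wave μ q ‖t‖ ψ) x := by
  have hq := hν.one_lt
  obtain ⟨J, hJ⟩ := hψ.exists_hasBand hq
  rw [wave, hψ.multiplier_multiplier hq, hJ.multiplier_eq_sum]
  simp only [hJ.wave_apply]
  rw [IsMeanZeroTest.multiplier_sum_mul hq _ _ fun j _ => isMeanZeroTest_waveProfile hν j]
  simp only [multiplier_waveProfile hν]
  exact Finset.sum_congr rfl fun j _ => by ring

end Existence

section Uniqueness

theorem eq_zero_of_mul_sub_mul_eq {R : Type*} [CommRing R] [IsDomain R] {q : R} (hq : q ≠ 0)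
    {a e : ℤ → R} (ha : a.Injective) {i : ℤ}
    (h : ∀ m, q * (a i - a m) * e m = (a i - a (m + 1)) * e (m + 1)) {m : ℤ} (hm : m ≠ i) :
    e m = 0 := by
  have hne {m : ℤ} (hm : m ≠ i) : a i - a m ≠ 0 := sub_ne_zero.2 (ha.ne hm.symm)
  rcases lt_or_gt_of_ne hm with hlt | hgt
  · refine Int.leInductionDown (m := i - 1) (motive := fun m _ => e m = 0) ?_ (fun m hm ih => ?_)
      m (by omega)
    · simpa [hq, hne] using h (i - 1)
    · simpa [hq, hne (show m - 1 ≠ i by omega), ih] using h (m - 1)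
  · refine Int.leInduction (m := i + 1) (motive := fun m _ => e m = 0) ?_ (fun m hm ih => ?_)
      m (by omega)
    · simpa [hne] using (h i).symm
    · simpa [hne (show m + 1 ≠ i by omega), ih] using (h m).symm

variable {T E : Type*} [NormedAddCommGroup T] [MeasurableSpace T] [NormedAddCommGroup E]
  [MeasurableSpace E]

/-- `F` solves the equation `a(D_t) F = a(D_x) F`, where both operators are multipliers with the
symbol `a`. It is radial in time, and a test function with integral zero both in time and in
space. -/
structure IsRadialWave (ν : Measure T) (μ : Measure E) (q : ℝ) (a : ℤ → ℂ) (F : T → E → ℂ) :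
    Prop where
  time : ∀ x, IsMeanZeroTest ν fun t => F t x
  radial : ∀ x s t, ‖s‖ = ‖t‖ → F s x = F t x
  space : ∀ t, IsMeanZeroTest μ (F t)
  equation : ∀ t x, multiplier ν q a (fun s => F s x) t = multiplier μ q a (F t) x

variable [ProperSpace T] [BorelSpace T] {ν : Measure T} [ν.IsAddHaarMeasure] {q : ℝ}

theorem mul_sub_eq_bandPass_of_radial (hν : IsNormalizedHaar ν q 1) {u : T → ℂ}
    (hu : LocallyIntegrable u ν) (hradial : ∀ s t, ‖s‖ = ‖t‖ → u s = u t) {m : ℤ} {s t : T}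
    (hs : ‖s‖ = q ^ (-m)) (ht : ‖t‖ = q ^ (-(m - 1))) :
    (q - 1) * (u s - u t) = q * bandPass ν q m u 0 - bandPass ν q (m + 1) u 0 := by
  have hus := mul_eq_lowPass_of_radial hν hu hradial hs
  have hut := mul_eq_lowPass_of_radial hν hu hradial ht
  rw [pow_one] at hus hut
  rw [sub_add_cancel] at hut
  rw [bandPass, bandPass, add_sub_cancel_right]
  linear_combination hus - hut

variable {μ : Measure E} {a : ℤ → ℂ} {F : T → E → ℂ}

theorem IsRadialWave.mul_sub_eq (hν : IsNormalizedHaar ν q 1) (hF : IsRadialWave ν μ q a F)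
    {m : ℤ} {s t : T} (hs : ‖s‖ = q ^ (-m)) (ht : ‖t‖ = q ^ (-(m - 1))) (x : E) :
    (q - 1) * (F s x - F t x) =
      q * bandPass ν q m (F · x) 0 - bandPass ν q (m + 1) (F · x) 0 :=
  mul_sub_eq_bandPass_of_radial hν (hF.time x).locallyIntegrable (hF.radial x) hs ht

variable [IsUltrametricDist T]

theorem multiplier_eq_of_radial (hν : IsNormalizedHaar ν q 1) {u : T → ℂ}
    (hu : LocallyIntegrable u ν) (hradial : ∀ s t, ‖s‖ = ‖t‖ → u s = u t) (a : ℤ → ℂ) (t : T) :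
    multiplier ν q a u t = ∑ᶠ j, a j * (waveProfile q j ‖t‖ * bandPass ν q j u 0) := by
  simp only [multiplier, ← bandPass_eq_waveProfile_mul hν hu hradial]

namespace IsRadialWave

theorem mul_sub_multiplier_eq (hν : IsNormalizedHaar ν q 1) (hF : IsRadialWave ν μ q a F) {m : ℤ}
    {s t : T} (hs : ‖s‖ = q ^ (-m)) (ht : ‖t‖ = q ^ (-(m - 1))) (x : E) :
    (q - 1) * (multiplier μ q a (F s) x - multiplier μ q a (F t) x) =
      q * (a m * bandPass ν q m (F · x) 0) - a (m + 1) * bandPass ν q (m + 1) (F · x) 0 := by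
  have hu := hF.time x
  rw [← hF.equation, ← hF.equation, ← hu.bandPass_multiplier hν.one_lt,
    ← hu.bandPass_multiplier hν.one_lt]
  refine mul_sub_eq_bandPass_of_radial hν (hu.multiplier hν.one_lt a).locallyIntegrable
    (fun s t h => ?_) hs ht
  simp only [multiplier_eq_of_radial hν hu.locallyIntegrable (hF.radial x), h]

variable [IsUltrametricDist E] [ProperSpace E] [BorelSpace E] [μ.IsAddHaarMeasure]

theorem isMeanZeroTest_bandPass (hν : IsNormalizedHaar ν q 1) (ha : a.Injective)
    (hF : IsRadialWave ν μ q a F) (m : ℤ) :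
    IsMeanZeroTest μ fun x => bandPass ν q m (F · x) 0 := by
  have hq := hν.one_lt
  obtain ⟨s, hs⟩ := hν.exists_norm_eq one_ne_zero m
  obtain ⟨t, ht⟩ := hν.exists_norm_eq one_ne_zero (m - 1)
  have hq0 : (q : ℂ) ≠ 0 := by exact_mod_cast (zero_lt_one.trans hq).ne'
  have ha0 : a (m + 1) - a m ≠ 0 := sub_ne_zero.2 (ha.ne (by omega))
  have hsolve (x : E) : bandPass ν q m (F · x) 0 = (q - 1) / (q * (a (m + 1) - a m)) *
      (a (m + 1) * (F s x - F t x) - (multiplier μ q a (F s) x - multiplier μ q a (F t) x)) := by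
    rw [div_mul_eq_mul_div, eq_div_iff (mul_ne_zero hq0 ha0)]
    linear_combination a (m + 1) * -hF.mul_sub_eq hν hs ht x + hF.mul_sub_multiplier_eq hν hs ht x
  simp only [hsolve]
  exact ((((hF.space s).sub (hF.space t)).const_mul _).sub
    (((hF.space s).multiplier hq a).sub ((hF.space t).multiplier hq a))).const_mul _

theorem bandPass_bandPass_eq_zero (hν : IsNormalizedHaar ν q 1) (ha : a.Injective)
    (hF : IsRadialWave ν μ q a F) {i m : ℤ} (hm : m ≠ i) (x : E) :
    bandPass μ q i (fun y => bandPass ν q m (F · y) 0) x = 0 := by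
  have hq := hν.one_lt
  have hq0 : (q : ℂ) ≠ 0 := by exact_mod_cast (zero_lt_one.trans hq).ne'
  have hd (m : ℤ) := hF.isMeanZeroTest_bandPass hν ha m
  refine eq_zero_of_mul_sub_mul_eq
    (e := fun m => bandPass μ q i (fun y => bandPass ν q m (F · y) 0) x) hq0 ha (fun m => ?_) hm
  obtain ⟨s, hs⟩ := hν.exists_norm_eq one_ne_zero m
  obtain ⟨t, ht⟩ := hν.exists_norm_eq one_ne_zero (m - 1)
  have hsub (c d c' : ℂ) {f g f' g' : E → ℂ} (hf : IsMeanZeroTest μ f) (hg : IsMeanZeroTest μ g)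
      (hf' : IsMeanZeroTest μ f') (hg' : IsMeanZeroTest μ g')
      (h : ∀ y, c' * (f' y - g' y) = c * f y - d * g y) :
      c' * (bandPass μ q i f' x - bandPass μ q i g' x) =
        c * bandPass μ q i f x - d * bandPass μ q i g x := by
    have := congrArg (bandPass μ q i · x) (funext h)
    simpa only [bandPass_const_mul, bandPass_sub (hf.const_mul c).locallyIntegrable
      (hg.const_mul d).locallyIntegrable, bandPass_sub hf'.locallyIntegrable
      hg'.locallyIntegrable] using this
  have h₁ := hsub q 1 (q - 1) (hd m) (hd (m + 1)) (hF.space s) (hF.space t) fun y => by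
    rw [hF.mul_sub_eq hν hs ht, one_mul]
  have h₂ := hsub (q * a m) (a (m + 1)) (q - 1) (hd m) (hd (m + 1))
    ((hF.space s).multiplier hq a) ((hF.space t).multiplier hq a) fun y => by
    rw [hF.mul_sub_multiplier_eq hν hs ht, mul_assoc]
  rw [(hF.space s).bandPass_multiplier hq, (hF.space t).bandPass_multiplier hq] at h₂
  linear_combination h₂ - a i * h₁

theorem bandPass_bandPass_self (hν : IsNormalizedHaar ν q 1) (ha : a.Injective)
    (hF : IsRadialWave ν μ q a F) (m : ℤ) :
    bandPass μ q m (fun x => bandPass ν q m (F · x) 0) = fun x => bandPass ν q m (F · x) 0 := by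
  have hq := hν.one_lt
  have hd := hF.isMeanZeroTest_bandPass hν ha m
  refine (hd.bandPass hq m).ext_bandPass hq hd fun i => ?_
  rw [bandPass_bandPass hq hd.locallyIntegrable]
  split_ifs with h
  · rw [h]
  · exact (funext fun x => hF.bandPass_bandPass_eq_zero hν ha (Ne.symm h) x).symm

theorem bandPass_time_eq (hν : IsNormalizedHaar ν q 1) (ha : a.Injective)
    (hF : IsRadialWave ν μ q a F) (j : ℤ) (x : E) :
    bandPass ν q j (F · x) 0 = bandPass μ q j (F 0) x := by
  have hq := hν.one_lt
  have hd (l : ℤ) := hF.isMeanZeroTest_bandPass hν ha l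
  let S (l : ℤ) (x : E) : ℂ := lowPass ν q l (F · x) 0 - lowPass μ q l (F 0) x
  have hband (l : ℤ) : (fun x => S l x - S (l - 1) x) =
      bandPass μ q l fun y => bandPass ν q l (F · y) 0 - F 0 y := by
    funext x
    rw [bandPass_sub (hd l).locallyIntegrable (hF.space 0).locallyIntegrable,
      hF.bandPass_bandPass_self hν ha]
    simp only [S, bandPass]
    ring
  obtain ⟨J, hJ⟩ := (hF.space 0).exists_hasBand hq
  have hS (l : ℤ) : S l = 0 := by
    refine eq_zero_of_lowPass_sub_eq_zero (μ := μ) hq (fun l => ?_) (fun l x => ?_) (fun x => ?_)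
      (fun x => ?_) l
    · rw [hband]
      exact isConstOnBalls_bandPass hq μ l _
    · rw [hband, lowPass_bandPass hq ((hd l).sub (hF.space 0)).locallyIntegrable,
        if_neg (by omega), Pi.zero_apply]
    · obtain ⟨L, hL⟩ := (hF.time x).exists_hasBand hq
      exact ⟨-max L J, fun l hl => by
        simp [S, hL.lowPass_eq_zero l (by omega), hJ.lowPass_eq_zero l (by omega)]⟩
    · obtain ⟨L, hL⟩ := (hF.time x).exists_hasBand hq
      exact ⟨max L J, fun l hl => by
        simp [S, hL.lowPass_eq_self l (by omega), hJ.lowPass_eq_self l (by omega)]⟩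
  have heq (l : ℤ) : lowPass ν q l (F · x) 0 = lowPass μ q l (F 0) x :=
    sub_eq_zero.1 (congrFun (hS l) x)
  rw [bandPass, bandPass, heq, heq]

theorem eq_wave (hν : IsNormalizedHaar ν q 1) (ha : a.Injective) (hF : IsRadialWave ν μ q a F)
    (t : T) : F t = wave μ q ‖t‖ (F 0) := by
  funext x
  rw [← congrFun ((hF.time x).multiplier_one hν.one_lt) t,
    multiplier_eq_of_radial hν (hF.time x).locallyIntegrable (hF.radial x)]
  simp only [one_mul, hF.bandPass_time_eq hν ha, wave, multiplier]

end IsRadialWave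

theorem isRadialWave_wave [IsUltrametricDist E] [ProperSpace E] [BorelSpace E] {μ : Measure E}
    [μ.IsAddHaarMeasure] (hν : IsNormalizedHaar ν q 1) (a : ℤ → ℂ) {ψ : E → ℂ}
    (hψ : IsMeanZeroTest μ ψ) : IsRadialWave ν μ q a fun t : T => wave μ q ‖t‖ ψ where
  time := isMeanZeroTest_wave_time hν hψ
  radial x s t h := by rw [h]
  space t := hψ.wave hν.one_lt _
  equation := multiplier_wave_time hν hψ a

end Uniqueness

section PowSymbol

variable {q : ℝ}

theorem powSymbol_injective (hq : 1 < q) {α : ℝ} (hα : α ≠ 0) :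
    (powSymbol q α).Injective := fun i j h => by
  have hpow (k : ℤ) : (0 : ℝ) ≤ q ^ k := by positivity
  exact zpow_right_injective₀ (by positivity) hq.ne'
    ((Real.rpow_left_inj (hpow i) (hpow j) hα).1 (Complex.ofReal_injective h))

theorem powSymbol_mul_neg (hq : 1 < q) (β : ℝ) (j : ℤ) :
    powSymbol q β j * powSymbol q (-β) j = 1 := by
  rw [powSymbol, powSymbol, ← Complex.ofReal_mul, ← Real.rpow_add (by positivity), add_neg_cancel,
    Real.rpow_zero, Complex.ofReal_one]

variable {E : Type*} [NormedAddCommGroup E] [IsUltrametricDist E] [ProperSpace E]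
  [MeasurableSpace E] [BorelSpace E] {μ : Measure E} [μ.IsAddHaarMeasure] {f : E → ℂ}

theorem IsMeanZeroTest.rieszPotential (hq : 1 < q) (hf : IsMeanZeroTest μ f) (β : ℝ) :
    IsMeanZeroTest μ (rieszPotential μ q β f) :=
  hf.multiplier hq _

theorem multiplier_powSymbol_rieszPotential (hq : 1 < q) (hf : IsMeanZeroTest μ f) (β : ℝ) :
    multiplier μ q (powSymbol q β) (rieszPotential μ q β f) = f := by
  simp only [rieszPotential, hf.multiplier_multiplier hq, powSymbol_mul_neg hq,
    hf.multiplier_one hq]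

theorem rieszPotential_multiplier_powSymbol (hq : 1 < q) (hf : IsMeanZeroTest μ f) (β : ℝ) :
    rieszPotential μ q β (multiplier μ q (powSymbol q β) f) = f := by
  simp only [rieszPotential, hf.multiplier_multiplier hq, mul_comm (powSymbol q (-β) _),
    powSymbol_mul_neg hq, hf.multiplier_one hq]

end PowSymbol

section LocalField

variable {K : Type*} [NontriviallyNormedField K] [IsUltrametricDist K] [LocallyCompactSpace K]
  [MeasurableSpace K] [BorelSpace K] {χ : AddChar K Circle} {n : ℕ} {α : ℝ}
  {φ : (Fin n → K) → ℂ} {F : K → (Fin n → K) → ℂ}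

local notation "qK" => (residueCard K : ℝ)

theorem isWaveSolution_iff (hK : IsNormalizedAbs K) (hχ : IsRankZero χ) :
    IsWaveSolution χ α F ↔ IsRadialWave (haar K) (haarPi K n) qK (powSymbol qK α) F := by
  refine ⟨fun h => ?_, fun h => ?_⟩
  · have htime x := isLizorkinLine_iff.1 (h.lizorkin_time x)
    have hspace t := isLizorkin_iff.1 (h.lizorkin_space t)
    refine ⟨htime, h.radial_time, hspace, fun t x => ?_⟩
    rw [← fracDerivLine_eq_multiplier hK hχ α (htime x),
      ← fracDeriv_eq_multiplier hK hχ α (hspace t), sub_eq_zero.1 (h.equation t x)]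
  · refine ⟨fun x => isLizorkinLine_iff.2 (h.time x), h.radial,
      fun t => isLizorkin_iff.2 (h.space t), fun t x => ?_⟩
    rw [fracDerivLine_eq_multiplier hK hχ α (h.time x), fracDeriv_eq_multiplier hK hχ α (h.space t),
      h.equation, sub_self]

theorem IsWaveSolution.eq_wave (hK : IsNormalizedAbs K) (hχ : IsRankZero χ) (hα : α ≠ 0)
    (hF : IsWaveSolution χ α F) (t : K) : F t = wave (haarPi K n) qK ‖t‖ (F 0) :=
  ((isWaveSolution_iff hK hχ).1 hF).eq_wave (isNormalizedHaar_haar hK)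
    (powSymbol_injective (one_lt_residueCard hK) hα) t

theorem isWaveSolution_wave (hK : IsNormalizedAbs K) (hχ : IsRankZero χ) (α : ℝ)
    (hφ : IsMeanZeroTest (haarPi K n) φ) :
    IsWaveSolution χ α fun t => wave (haarPi K n) qK ‖t‖ φ :=
  (isWaveSolution_iff hK hχ).2 (isRadialWave_wave (isNormalizedHaar_haar hK) _ hφ)

theorem isCauchySolution_iff (hK : IsNormalizedAbs K) (hχ : IsRankZero χ) (hα : α ≠ 0)
    (hφ : IsMeanZeroTest (haarPi K n) φ) :
    IsCauchySolution χ α φ F ↔ F = fun t => wave (haarPi K n) qK ‖t‖ φ := by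
  constructor
  · intro hF
    rw [← funext hF.initial]
    exact funext (hF.toIsWaveSolution.eq_wave hK hχ hα)
  · rintro rfl
    refine ⟨isWaveSolution_wave hK hχ α hφ, fun x => ?_⟩
    rw [norm_zero, wave_zero (one_lt_residueCard hK) hφ]

theorem IsWaveSolution.fracDerivLine_zero (hK : IsNormalizedAbs K) (hχ : IsRankZero χ)
    (hα : α ≠ 0) (hF : IsWaveSolution χ α F) (β : ℝ) (x : Fin n → K) :
    fracDerivLine χ β (fun s => F s x) 0 =
      multiplier (haarPi K n) qK (powSymbol qK β) (F 0) x := by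
  have hF0 := isLizorkin_iff.1 (hF.lizorkin_space 0)
  rw [fracDerivLine_eq_multiplier hK hχ β (isLizorkinLine_iff.1 (hF.lizorkin_time x))]
  rw [funext fun s => congrFun (hF.eq_wave hK hχ hα s) x,
    multiplier_wave_time (isNormalizedHaar_haar hK) hF0, norm_zero,
    wave_zero (one_lt_residueCard hK) hF0]

theorem isModifiedCauchySolution_iff (hK : IsNormalizedAbs K) (hχ : IsRankZero χ) (hα : α ≠ 0)
    (hφ : IsMeanZeroTest (haarPi K n) φ) :
    IsModifiedCauchySolution χ α φ F ↔
      F = fun t => wave (haarPi K n) qK ‖t‖ (rieszPotential (haarPi K n) qK (n - 1) φ) := by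
  have hq := one_lt_residueCard hK
  constructor
  · intro hF
    have hF0 : φ = multiplier (haarPi K n) qK (powSymbol qK (n - 1)) (F 0) := funext fun x => by
      rw [← hF.toIsWaveSolution.fracDerivLine_zero hK hχ hα, hF.initial]
    rw [hF0, rieszPotential_multiplier_powSymbol hq (isLizorkin_iff.1 (hF.lizorkin_space 0))]
    exact funext (hF.toIsWaveSolution.eq_wave hK hχ hα)
  · rintro rfl
    have hψ := hφ.rieszPotential hq (n - 1)
    have hF := isWaveSolution_wave hK hχ α hψ
    refine ⟨hF, fun x => (hF.fracDerivLine_zero hK hχ hα (n - 1) x).trans ?_⟩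
    rw [norm_zero, wave_zero hq hψ, multiplier_powSymbol_rieszPotential hq hφ]

theorem conv_kernelB_eq_wave (hK : IsNormalizedAbs K) {t : K} (ht : t ≠ 0)
    (hφ : IsMeanZeroTest (haarPi K n) φ) :
    conv (kernelB t) φ = wave (haarPi K n) qK ‖t‖ φ := by
  obtain ⟨k, hk⟩ := norm_eq_zpow hK ht
  rw [← neg_neg k] at hk
  rw [hk, wave_zpow (one_lt_residueCard hK) hφ]
  exact funext (conv_kernelB hK hk hφ.toIsTest)

theorem conv_kernelA_conv_kernelB_eq_wave (hK : IsNormalizedAbs K) (hn : 2 ≤ n) {t : K}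
    (ht : t ≠ 0) (hφ : IsMeanZeroTest (haarPi K n) φ) :
    conv kernelA (conv (kernelB t) φ) =
      wave (haarPi K n) qK ‖t‖ (rieszPotential (haarPi K n) qK (n - 1) φ) := by
  have hq := one_lt_residueCard hK
  rw [conv_kernelB_eq_wave hK ht hφ, conv_kernelA hK hn (hφ.wave hq _),
    rieszPotential, rieszPotential, wave_multiplier hq hφ]

theorem convExists_kernelA_conv_kernelB (hK : IsNormalizedAbs K) (hn : 2 ≤ n) {t : K}
    (ht : t ≠ 0) (hφ : IsMeanZeroTest (haarPi K n) φ) :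
    ConvExists kernelA (conv (kernelB t) φ) := by
  rw [conv_kernelB_eq_wave hK ht hφ]
  exact convExists_kernelA hK hn (hφ.wave (one_lt_residueCard hK) _).toIsTest

theorem wave_zero_eq_conv_kernelA (hK : IsNormalizedAbs K) (hn : 2 ≤ n)
    (hφ : IsMeanZeroTest (haarPi K n) φ) :
    wave (haarPi K n) qK ‖(0 : K)‖ (rieszPotential (haarPi K n) qK (n - 1) φ) =
      conv kernelA φ := by
  have hq := one_lt_residueCard hK
  rw [norm_zero, wave_zero hq (hφ.rieszPotential hq _), conv_kernelA hK hn hφ]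

theorem IsCauchySolution.normL_le (hK : IsNormalizedAbs K) (hχ : IsRankZero χ) (hα : α ≠ 0)
    (hφ : IsMeanZeroTest (haarPi K n) φ) (hF : IsCauchySolution χ α φ F) {κ : ℝ} (hκ : 1 ≤ κ)
    (t : K) : normL κ (F t) ≤ (qK / (qK - 1) + (qK - 1)⁻¹).toNNReal * normL κ φ := by
  rw [(isCauchySolution_iff hK hχ hα hφ).1 hF]
  exact eLpNorm_wave_le (isNormalizedHaar_haar hK) hφ hκ t

theorem IsModifiedCauchySolution.normL_le (hK : IsNormalizedAbs K) (hχ : IsRankZero χ)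
    (hn : 2 ≤ n) (hα : α ≠ 0) (hφ : IsMeanZeroTest (haarPi K n) φ)
    (hF : IsModifiedCauchySolution χ α φ F) {κ : ℝ} (hκ : 1 ≤ κ) (t : K) :
    normL κ (F t) ≤ (qK / (qK - 1) + (qK - 1)⁻¹).toNNReal * normL κ (conv kernelA φ) := by
  rw [(isModifiedCauchySolution_iff hK hχ hα hφ).1 hF, conv_kernelA hK hn hφ]
  exact eLpNorm_wave_le (isNormalizedHaar_haar hK)
    (hφ.rieszPotential (one_lt_residueCard hK) _) hκ t

theorem exists_normL_wave_rieszPotential_le (hK : IsNormalizedAbs K) (hn : 2 ≤ n) {κ : ℝ}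
    (hκ : 1 < κ) (hκn : κ < n / (n - 1)) :
    ∃ C : ℝ≥0, ∀ φ : (Fin n → K) → ℂ, IsMeanZeroTest (haarPi K n) φ → ∀ t : K,
      normL (n * κ / (n - κ * (n - 1)))
        (wave (haarPi K n) qK ‖t‖ (rieszPotential (haarPi K n) qK (n - 1) φ)) ≤
      C * normL κ φ :=
  have hn1 : (0 : ℝ) < n - 1 := sub_pos.2 (Nat.one_lt_cast.2 hn)
  exists_eLpNorm_wave_rieszPotential_le (isNormalizedHaar_haar hK) (isNormalizedHaar_haarPi hK n)
    hn1 hκ ((lt_div_iff₀ hn1).1 hκn)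

end LocalField

end NAWave

theorem mainTheorem6_general {K : Type*} [NontriviallyNormedField K] [IsUltrametricDist K]
    [LocallyCompactSpace K] [MeasurableSpace K] [BorelSpace K]
    (hK : IsNormalizedAbs K) (χ : AddChar K Circle) (hχ : IsRankZero χ) :
    (∀ n : ℕ, 2 ≤ n →
      (∀ (α : ℝ) (φ : (Fin n → K) → ℂ), α ≠ 0 → IsLizorkin φ →
        ∃ F : K → (Fin n → K) → ℂ,
          IsModifiedCauchySolution χ α φ F ∧
          (∀ G, IsModifiedCauchySolution χ α φ G → G = F) ∧
          (∀ t : K, t ≠ 0 →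
            ConvExists (kernelB t) φ ∧ ConvExists kernelA (conv (kernelB t) φ) ∧
            F t = conv kernelA (conv (kernelB t) φ)) ∧
          (ConvExists kernelA φ ∧ F 0 = conv kernelA φ)) ∧
      (∃ C : ℝ≥0, ∀ (α : ℝ) (φ : (Fin n → K) → ℂ) (F : K → (Fin n → K) → ℂ) (κ : ℝ),
        α ≠ 0 → IsLizorkin φ → IsModifiedCauchySolution χ α φ F → 1 ≤ κ →
        ∀ t : K, normL κ (F t) ≤ C * normL κ (conv kernelA φ)) ∧
      (∀ κ : ℝ, 1 < κ → κ < (n : ℝ) / ((n : ℝ) - 1) →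
        ∃ C' : ℝ≥0, ∀ (α : ℝ) (φ : (Fin n → K) → ℂ) (F : K → (Fin n → K) → ℂ),
          α ≠ 0 → IsLizorkin φ → IsModifiedCauchySolution χ α φ F →
          ∀ t : K,
            normL ((n : ℝ) * κ / ((n : ℝ) - κ * ((n : ℝ) - 1))) (F t) ≤ C' * normL κ φ)) ∧
    (∀ n : ℕ,
      (∀ (α : ℝ) (φ : (Fin n → K) → ℂ), α ≠ 0 → IsLizorkin φ →
        ∃ F : K → (Fin n → K) → ℂ,
          IsCauchySolution χ α φ F ∧
          (∀ G, IsCauchySolution χ α φ G → G = F) ∧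
          (∀ t : K, t ≠ 0 → ConvExists (kernelB t) φ ∧ F t = conv (kernelB t) φ)) ∧
      (∃ C : ℝ≥0, ∀ (α : ℝ) (φ : (Fin n → K) → ℂ) (F : K → (Fin n → K) → ℂ) (κ : ℝ),
        α ≠ 0 → IsLizorkin φ → IsCauchySolution χ α φ F → 1 ≤ κ →
        ∀ t : K, normL κ (F t) ≤ C * normL κ φ)) := by
  simp only [isLizorkin_iff]
  exact ⟨fun n hn =>
    ⟨fun α φ hα hφ =>
      ⟨_, (isModifiedCauchySolution_iff hK hχ hα hφ).2 rfl,
        fun G => (isModifiedCauchySolution_iff hK hχ hα hφ).1,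
        fun t ht => ⟨convExists_kernelB hK ht hφ.toIsTest,
          convExists_kernelA_conv_kernelB hK hn ht hφ,
          (conv_kernelA_conv_kernelB_eq_wave hK hn ht hφ).symm⟩,
        convExists_kernelA hK hn hφ.toIsTest, wave_zero_eq_conv_kernelA hK hn hφ⟩,
      ⟨_, fun α φ F κ hα hφ hF => hF.normL_le hK hχ hn hα hφ⟩,
      fun κ hκ hκn => (exists_normL_wave_rieszPotential_le hK hn hκ hκn).imp
        fun C hC α φ F hα hφ hF t => (isModifiedCauchySolution_iff hK hχ hα hφ).1 hF ▸ hC φ hφ t⟩,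
    fun n =>
    ⟨fun α φ hα hφ =>
      ⟨_, (isCauchySolution_iff hK hχ hα hφ).2 rfl, fun G => (isCauchySolution_iff hK hχ hα hφ).1,
        fun t ht => ⟨convExists_kernelB hK ht hφ.toIsTest,
          (conv_kernelB_eq_wave hK ht hφ).symm⟩⟩,
      ⟨_, fun α φ F κ hα hφ hF => hF.normL_le hK hχ hα hφ⟩⟩⟩

theorem mainTheorem6 {K : Type*} [NontriviallyNormedField K] [IsUltrametricDist K]
    [LocallyCompactSpace K] [MeasurableSpace K] [BorelSpace K]
    (hK : IsNormalizedAbs K) (χ : AddChar K Circle) (hχ : IsRankZero χ) :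
    -- the modified Cauchy problem, `n ≥ 2`
    (∀ n : ℕ, 2 ≤ n →
      -- existence, uniqueness and representation of the solution
      (∀ (α : ℝ) (φ : (Fin n → K) → ℂ), 0 < α → IsLizorkin φ →
        ∃ F : K → (Fin n → K) → ℂ,
          IsModifiedCauchySolution χ α φ F ∧
          (∀ G, IsModifiedCauchySolution χ α φ G → G = F) ∧
          (∀ t : K, t ≠ 0 →
            ConvExists (kernelB t) φ ∧ ConvExists kernelA (conv (kernelB t) φ) ∧
            F t = conv kernelA (conv (kernelB t) φ)) ∧
          (ConvExists kernelA φ ∧ F 0 = conv kernelA φ)) ∧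
      -- the bound by the potential `A * φ`
      (∃ C : ℝ≥0, ∀ (α : ℝ) (φ : (Fin n → K) → ℂ) (F : K → (Fin n → K) → ℂ) (κ : ℝ),
        0 < α → IsLizorkin φ → IsModifiedCauchySolution χ α φ F → 1 < κ →
        ∀ t : K, normL κ (F t) ≤ C * normL κ (conv kernelA φ)) ∧
      -- the `L_κ → L_λ` bound
      (∀ κ : ℝ, 1 < κ → κ < (n : ℝ) / ((n : ℝ) - 1) →
        ∃ C' : ℝ≥0, ∀ (α : ℝ) (φ : (Fin n → K) → ℂ) (F : K → (Fin n → K) → ℂ),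
          0 < α → IsLizorkin φ → IsModifiedCauchySolution χ α φ F →
          ∀ t : K,
            normL ((n : ℝ) * κ / ((n : ℝ) - κ * ((n : ℝ) - 1))) (F t) ≤ C' * normL κ φ)) ∧
    -- the Cauchy problem, `n ≥ 1`
    (∀ n : ℕ, 1 ≤ n →
      (∀ (α : ℝ) (φ : (Fin n → K) → ℂ), 0 < α → IsLizorkin φ →
        ∃ F : K → (Fin n → K) → ℂ,
          IsCauchySolution χ α φ F ∧
          (∀ G, IsCauchySolution χ α φ G → G = F) ∧
          (∀ t : K, t ≠ 0 → ConvExists (kernelB t) φ ∧ F t = conv (kernelB t) φ)) ∧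
      (∃ C : ℝ≥0, ∀ (α : ℝ) (φ : (Fin n → K) → ℂ) (F : K → (Fin n → K) → ℂ) (κ : ℝ),
        0 < α → IsLizorkin φ → IsCauchySolution χ α φ F → 1 < κ →
        ∀ t : K, normL κ (F t) ≤ C * normL κ φ)) := by
  obtain ⟨hmod, hcau⟩ := mainTheorem6_general hK χ hχ
  exact ⟨fun n hn => (hmod n hn).imp (fun h α φ hα => h α φ hα.ne') <| .imp
      (.imp fun C h α φ F κ hα hφ hF hκ => h α φ F κ hα.ne' hφ hF hκ.le)
      fun h κ h1 hn => (h κ h1 hn).imp fun C h α φ F hα => h α φ F hα.ne',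
    fun n _ => (hcau n).imp (fun h α φ hα => h α φ hα.ne')
      (.imp fun C h α φ F κ hα hφ hF hκ => h α φ F κ hα.ne' hφ hF hκ.le)⟩
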